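/- Let $K\ge 1$ sensors observe, at times $t=1,2,\dots$, samples $y^k_t$ that are independent across time and across sensors, the samples of sensor $k$ being identically distributed with density $f^k_i$ under hypothesis $\mathsf H_i$, $i=0,1$; let $\mathsf P_i,\mathsf E_i$ be the corresponding probability and expectation. Let $l^k_t=\log\frac{f_1^k(y^k_t)}{f_0^k(y^k_t)}$, assume that these log-likelihood ratios are well defined and satisfy $|l^k_t|<\phi$ almost surely under both hypotheses for a constant $\phi<\infty$, and put $L^k_t=\sum_{n=1}^t l^k_n$, $L_t=\sum_{k=1}^K L^k_t$ and $\mathsf I_i=\frac1K|\mathsf E_i[L_1]|$. The centralized SPRT with thresholds $A,B>0$ stops at $\mathcal S=\inf\{t>0: L_t\notin(-B,A)\}$ and decides $\mathsf H_1$ if $L_{\mathcal S}\ge A$ and $\mathsf H_0$ if $L_{\mathcal S}\le -B$. For a period $T\ge1$ and $\tilde r\ge 1$ quantization levels put $\lambda^k_{mT}=L^k_{mT}-L^k_{(m-1)T}$, $$\tilde\lambda^k_{mT}=-T\phi+\frac{T\phi}{\tilde r}+\left\lfloor\frac{\tilde r(\lambda^k_{mT}+T\phi)}{2T\phi}\right\rfloor\frac{2T\phi}{\tilde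 r},\qquad \tilde L_{mT}=\sum_{n=1}^m\sum_{k=1}^K\tilde\lambda^k_{nT}.$$ Q-SPRT with thresholds $\tilde A,\tilde B>0$ stops at $\tilde{\mathcal S}=T\mathcal M$, $\mathcal M=\inf\{m>0:\tilde L_{mT}\notin(-\tilde B,\tilde A)\}$, and decides $\mathsf H_1$ if $\tilde L_{\tilde{\mathcal S}}\ge\tilde A$ and $\mathsf H_0$ if $\tilde L_{\tilde{\mathcal S}}\le-\tilde B$. Suppose that the thresholds of both tests are such that both tests have Type-I error probability ($\mathsf P_0$ of deciding $\mathsf H_1$) exactly $\alpha\in(0,1)$ and Type-II error probability ($\mathsf P_1$ of deciding $\mathsf H_0$) exactly $\beta\in(0,1)$. If $\alpha,\beta\to0$ at the same rate (that is, $C^{-1}\alpha\le\beta\le C\alpha$ for some constant $C$) and $\tilde r\to\infty$, then the expected stopping times are finite for all sufficiently large $\tilde r$ and $$0\le\mathsf E_1[\tilde{\mathcal S}]-\mathsf E_1[\mathcal S]\le\frac{2|\log\alpha|}{K\mathsf I_1^2}\frac{\phi}{\tilde r}\{1+o_{\tilde r}(1)\}+T\frac{\phi}{\mathsf I_1}\{1+o_{\tilde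 r}(1)\}+o_\alpha(1),$$ $$0\le\mathsf E_0[\tilde{\mathcal S}]-\mathsf E_0[\mathcal S]\le\frac{2|\log\beta|}{K\mathsf I_0^2}\frac{\phi}{\tilde r}\{1+o_{\tilde r}(1)\}+T\frac{\phi}{\mathsf I_0}\{1+o_{\tilde r}(1)\}+o_\beta(1).$$ Here, for a given observation model and $\phi$, each $o_{\tilde r}(1)$ is a function of $\tilde r$ alone that tends to $0$ as $\tilde r\to\infty$, and $o_\alpha(1)$ (resp. $o_\beta(1)$) is, for given $C$, a function of $\alpha$ (resp. $\beta$) alone that tends to $0$ as $\alpha\to0$ (resp. $\beta\to0$). -/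

import Mathlib

open MeasureTheory ProbabilityTheory Filter Topology
open scoped ENNReal

namespace QSPRT

noncomputable section

/-- `f` is a probability density function with respect to the reference measure `ν`. -/
def IsDensity {X : Type*} [MeasurableSpace X] (ν : Measure X) (f : X → ℝ) : Prop :=
  Measurable f ∧ (∀ x, 0 ≤ f x) ∧ ∫⁻ x, ENNReal.ofReal (f x) ∂ν = 1

/-- Under the probability measure `P` all observations `y k t` (sensor `k`, time `t`) are
independent, across sensors and across time, and each observation of sensor `k` has density `f k`
with respect to `ν k`. -/
def ObservationLaw {Ω : Type*} [MeasurableSpace Ω] {K : ℕ} {Y : Fin K → Type*}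
    [∀ k, MeasurableSpace (Y k)] (ν : ∀ k, Measure (Y k)) (f : ∀ k, Y k → ℝ)
    (y : ∀ k, ℕ → Ω → Y k) (P : Measure Ω) : Prop :=
  (∀ k t, P.map (y k t) = (ν k).withDensity (fun x => ENNReal.ofReal (f k x))) ∧
    iIndepFun (fun p : Fin K × ℕ => y p.1 p.2) P

section Statistics

variable {Ω : Type*} {K : ℕ} {Y : Fin K → Type*}

/-- The log-likelihood ratio increment of one observation. The sample which is number `t + 1` in
time (counted from `1`) is stored at index `t`. -/
def llrIncrement (f₀ f₁ : ∀ k, Y k → ℝ) (y : ∀ k, ℕ → Ω → Y k) (k : Fin K) (t : ℕ) (ω : Ω) : ℝ :=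
  Real.log (f₁ k (y k t ω) / f₀ k (y k t ω))

/-- The local cumulative log-likelihood ratio of sensor `k` after `t` samples. -/
def localLLR (f₀ f₁ : ∀ k, Y k → ℝ) (y : ∀ k, ℕ → Ω → Y k) (k : Fin K) (t : ℕ) (ω : Ω) : ℝ :=
  ∑ n ∈ Finset.range t, llrIncrement f₀ f₁ y k n ω

/-- The global cumulative log-likelihood ratio after `t` samples per sensor. -/
def globalLLR (f₀ f₁ : ∀ k, Y k → ℝ) (y : ∀ k, ℕ → Ω → Y k) (t : ℕ) (ω : Ω) : ℝ :=
  ∑ k, localLLR f₀ f₁ y k t ω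

/-- The uniform mid-point quantizer of the interval `(-Tφ, Tφ)` with `r` levels. -/
def quantize (φ : ℝ) (T r : ℕ) (x : ℝ) : ℝ :=
  -(T * φ) + T * φ / r + (⌊r * (x + T * φ) / (2 * (T * φ))⌋ : ℝ) * (2 * (T * φ) / r)

/-- The fusion center's running statistic after `m` communication periods: the sum, over the
periods and the sensors, of the quantized local log-likelihood ratio increments. -/
def quantizedLLR (f₀ f₁ : ∀ k, Y k → ℝ) (y : ∀ k, ℕ → Ω → Y k) (φ : ℝ) (T r : ℕ)
    (m : ℕ) (ω : Ω) : ℝ :=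
  ∑ j ∈ Finset.range m, ∑ k,
    quantize φ T r (localLLR f₀ f₁ y k ((j + 1) * T) ω - localLLR f₀ f₁ y k (j * T) ω)

end Statistics

section TwoSidedTests

variable {Ω : Type*}

/-- The first index `n > 0` at which the process `Z` is outside the interval `(-B, A)`
(`⊤` if there is none). -/
def exitTime (Z : ℕ → Ω → ℝ) (A B : ℝ) : Ω → ℕ∞ :=
  hittingAfter Z (Set.Ioo (-B) A)ᶜ 1

/-- The event that the two-sided test of `Z` stops and selects the hypothesis `H₁`. -/
def decideOne (Z : ℕ → Ω → ℝ) (A B : ℝ) : Set Ω :=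
  {ω | ∃ n : ℕ, exitTime Z A B ω = n ∧ A ≤ Z n ω}

/-- The event that the two-sided test of `Z` stops and selects the hypothesis `H₀`. -/
def decideZero (Z : ℕ → Ω → ℝ) (A B : ℝ) : Set Ω :=
  {ω | ∃ n : ℕ, exitTime Z A B ω = n ∧ Z n ω ≤ -B}

/-- The thresholds `A, B > 0` make the two-sided test of `Z` meet the two error probability
constraints with equality: Type-I error `α` under `P₀` and Type-II error `β` under `P₁`. -/
def MeetsErrors [MeasurableSpace Ω] (P₀ P₁ : Measure Ω) (Z : ℕ → Ω → ℝ) (A B α β : ℝ) : Prop :=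
  0 < A ∧ 0 < B ∧ P₀.real (decideOne Z A B) = α ∧ P₁.real (decideZero Z A B) = β

/-- The expectation under `P` of a random time, which may be infinite. -/
def expectedTime [MeasurableSpace Ω] (P : Measure Ω) (τ : Ω → ℕ∞) : ℝ≥0∞ :=
  ∫⁻ ω, ((τ ω : ℕ∞) : ℝ≥0∞) ∂P

end TwoSidedTests

section Schemes

variable {Ω : Type*} {K : ℕ} {Y : Fin K → Type*}

/-- The average Kullback-Leibler information number `|E[L₁]| / K` under `P`. -/
def infoNumber [MeasurableSpace Ω] (f₀ f₁ : ∀ k, Y k → ℝ) (y : ∀ k, ℕ → Ω → Y k)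
    (P : Measure Ω) : ℝ :=
  |∫ ω, globalLLR f₀ f₁ y 1 ω ∂P| / K

/-- The stopping time of the centralized SPRT with thresholds `-B, A`. -/
def sprtTime (f₀ f₁ : ∀ k, Y k → ℝ) (y : ∀ k, ℕ → Ω → Y k) (A B : ℝ) : Ω → ℕ∞ :=
  exitTime (globalLLR f₀ f₁ y) A B

/-- The stopping time of Q-SPRT with thresholds `-B, A`: `T` times the number of communication
periods until the quantized statistic leaves `(-B, A)`. -/
def qsprtTime (f₀ f₁ : ∀ k, Y k → ℝ) (y : ∀ k, ℕ → Ω → Y k) (φ : ℝ) (T r : ℕ) (A B : ℝ) :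
    Ω → ℕ∞ :=
  fun ω => (T : ℕ∞) * exitTime (quantizedLLR f₀ f₁ y φ T r) A B ω

end Schemes

end

end QSPRT

/-! Both inequalities are proved for an abstract model (`LLRModel`): under `P` a random walk with
bounded i.i.d. increments whose exponential `exp (-walk)` is the density of `Q` with respect to `P`
along a filtration. The case of `H₀` follows by exchanging the hypotheses, which negates the walk
and swaps thresholds, decisions and error probabilities.

Nonnegativity of the difference is the optimality of the SPRT. The quantized test stops at multiples
of `T` using only the observations, so it competes with the same error probabilities, and
`wald_wolfowitz` applies. That theorem is proved by optimal stopping under `P` alone: each step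
costs 1, and stopping costs `min (w₀ u) w₁` in the state `u = dQ/dP`. The value function is
increasing and sublinear in `u`. The weights are chosen so that stopping at either boundary costs as
much as continuing to the next exit; the gains of continuing over stopping at the two boundaries
then bound each other and vanish, so the SPRT attains the optimal value.

For the upper bound let `μ` be the drift of the walk, `b = Kφ` the bound on its increments and `δ =
b / r` the quantization error per step. Wald's identity gives at most `(A' + T b) / (μ - δ)` for the
quantized test (`approx_expectedTime_le`). An exponential supermartingale gives `A' ≤ |log α| / (1 -
d)` with `d = δ/μ + O(δ²)` (`error_le_exp`, `approx_threshold_le`). The SPRT needs at least `|log α|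
/ μ` up to a term of order `β |log α|` (`sprt_lower_bound`). In the difference, the factors `1 - d`
and `μ - δ` each contribute `δ / μ²` to the coefficient of `|log α|`, which explains the constant 2;
overshoot over one period contributes `T b / (μ - δ)`. Here `μ = K I`. -/

namespace QSPRT

noncomputable section

/-! ### Optimal stopping: value iteration and the Bellman equation. -/

section ValueFunction

/-- Value iteration for the optimal stopping problem with unit cost per step and terminal cost
`min (w₀ u) w₁`, where the state `u` is multiplied in each step by `exp (-s)` with `s ∼ ρ`. -/
def valueIter (ρ : Measure ℝ) (w₀ w₁ : ℝ) : ℕ → ℝ → ℝ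
  -- Clipping at 0 gives nonnegativity and monotonicity on the whole line; only states `u ≥ 0`
  -- matter.
  | 0, u => min (w₀ * max u 0) w₁
  | n + 1, u => min (min (w₀ * max u 0) w₁) (1 + ∫ s, valueIter ρ w₀ w₁ n (u * Real.exp (-s)) ∂ρ)

variable {ρ : Measure ℝ} {w₀ w₁ : ℝ}

lemma valueIter_nonneg (h₀ : 0 ≤ w₀) (h₁ : 0 ≤ w₁) (n : ℕ) (u : ℝ) :
    0 ≤ valueIter ρ w₀ w₁ n u := by
  have h : 0 ≤ min (w₀ * max u 0) w₁ := by positivity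
  induction n generalizing u with
  | zero => exact h
  | succ n ih =>
    refine le_min h ?_
    have := integral_nonneg (μ := ρ) (f := fun s => valueIter ρ w₀ w₁ n (u * Real.exp (-s)))
      (fun s => ih _ (by positivity))
    linarith

lemma valueIter_le_terminal (n : ℕ) (u : ℝ) :
    valueIter ρ w₀ w₁ n u ≤ min (w₀ * max u 0) w₁ := by
  cases n with
  | zero => exact le_rfl
  | succ n => exact min_le_left _ _

lemma valueIter_le (n : ℕ) (u : ℝ) : valueIter ρ w₀ w₁ n u ≤ w₁ :=
  (valueIter_le_terminal n u).trans (min_le_right _ _)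

lemma measurable_continuation [SFinite ρ] {V : ℝ → ℝ} (hV : Measurable V) :
    Measurable fun u : ℝ => ∫ s, V (u * Real.exp (-s)) ∂ρ := by
  have : StronglyMeasurable (fun p : ℝ × ℝ => V (p.1 * Real.exp (-p.2))) :=
    (hV.comp (by fun_prop)).stronglyMeasurable
  exact this.integral_prod_right.measurable

lemma measurable_valueIter [SFinite ρ] (n : ℕ) : Measurable (valueIter ρ w₀ w₁ n) := by
  induction n with
  | zero =>
    change Measurable fun u : ℝ => min (w₀ * max u 0) w₁
    fun_prop
  | succ n ih =>
    have h := measurable_continuation (ρ := ρ) ih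
    change Measurable fun u : ℝ => min (min (w₀ * max u 0) w₁)
      (1 + ∫ s, valueIter ρ w₀ w₁ n (u * Real.exp (-s)) ∂ρ)
    fun_prop

lemma integrable_comp_of_bdd [IsFiniteMeasure ρ] {V : ℝ → ℝ} {c : ℝ} (hV : Measurable V)
    (h0 : ∀ u, 0 ≤ V u) (hc : ∀ u, V u ≤ c) (u : ℝ) :
    Integrable (fun s => V (u * Real.exp (-s))) ρ := by
  refine Integrable.of_bound (hV.comp (by fun_prop)).aestronglyMeasurable c
    (Eventually.of_forall fun s => ?_)
  rw [Real.norm_eq_abs, abs_of_nonneg (h0 _)]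
  exact hc _

variable [IsProbabilityMeasure ρ]

lemma integrable_valueIter (h₀ : 0 ≤ w₀) (h₁ : 0 ≤ w₁) (n : ℕ) (u : ℝ) :
    Integrable (fun s => valueIter ρ w₀ w₁ n (u * Real.exp (-s))) ρ :=
  integrable_comp_of_bdd (measurable_valueIter n) (valueIter_nonneg h₀ h₁ n)
    (valueIter_le n) u

lemma valueIter_succ_le (h₀ : 0 ≤ w₀) (h₁ : 0 ≤ w₁) (n : ℕ) (u : ℝ) :
    valueIter ρ w₀ w₁ (n + 1) u ≤ valueIter ρ w₀ w₁ n u := by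
  induction n generalizing u with
  | zero => exact min_le_left _ _
  | succ n ih =>
    refine min_le_min_left _ (add_le_add_right ?_ 1)
    exact integral_mono (integrable_valueIter h₀ h₁ _ _) (integrable_valueIter h₀ h₁ _ _)
      (fun s => ih _)

lemma monotone_valueIter (h₀ : 0 ≤ w₀) (h₁ : 0 ≤ w₁) (n : ℕ) :
    Monotone (valueIter ρ w₀ w₁ n) := by
  have ht : Monotone fun u : ℝ => min (w₀ * max u 0) w₁ := fun u v huv => by
    dsimp only
    gcongr
  induction n with
  | zero => exact ht
  | succ n ih =>
    intro u v huv
    refine min_le_min (ht huv) (add_le_add_right ?_ 1)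
    exact integral_mono (integrable_valueIter h₀ h₁ _ _) (integrable_valueIter h₀ h₁ _ _)
      (fun s => ih (by gcongr))

/-- Antitonicity of `V u / u`, written without division. It survives minima, positive constants and
averaging over rescalings of `u`. Together with monotonicity it makes the continuation region an
interval. -/
lemma valueIter_mul_le (h₀ : 0 ≤ w₀) (h₁ : 0 ≤ w₁) (n : ℕ) {u v : ℝ} (hu : 0 ≤ u) (huv : u ≤ v) :
    valueIter ρ w₀ w₁ n v * u ≤ valueIter ρ w₀ w₁ n u * v := by
  have hv := hu.trans huv
  have ht : ∀ {u v : ℝ}, 0 ≤ u → u ≤ v →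
      min (w₀ * max v 0) w₁ * u ≤ min (w₀ * max u 0) w₁ * v := by
    intro u v hu huv
    rw [max_eq_left hu, max_eq_left (hu.trans huv), min_mul_of_nonneg _ _ (hu.trans huv),
      min_mul_of_nonneg _ _ hu]
    exact min_le_min (le_of_eq (by ring)) (by gcongr)
  induction n generalizing u v with
  | zero => exact ht hu huv
  | succ n ih =>
    change min (min (w₀ * max v 0) w₁) _ * u ≤ min (min (w₀ * max u 0) w₁) _ * v
    rw [min_mul_of_nonneg _ _ hv, min_mul_of_nonneg _ _ hu]
    refine min_le_min (ht hu huv) ?_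
    rw [add_mul, add_mul, ← integral_mul_const, ← integral_mul_const]
    refine add_le_add (by linarith) (integral_mono ((integrable_valueIter h₀ h₁ n v).mul_const u)
      ((integrable_valueIter h₀ h₁ n u).mul_const v) fun s => ?_)
    have hs := Real.exp_pos (-s)
    have := ih (u := u * Real.exp (-s)) (v := v * Real.exp (-s)) (by positivity) (by gcongr)
      (by positivity)
    dsimp only
    -- The induction hypothesis carries the factor `exp (-s)` on both sides, which is cancelled
    -- here.
    nlinarith

/-- The value function of the optimal stopping problem exists, is monotone and sublinear, and solves
the Bellman equation. -/
lemma exists_valueFunction (ρ : Measure ℝ) [IsProbabilityMeasure ρ]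
    (h₀ : 0 ≤ w₀) (h₁ : 0 ≤ w₁) :
    ∃ V : ℝ → ℝ, Measurable V ∧ (∀ u, 0 ≤ V u) ∧ (∀ u, V u ≤ w₁) ∧ Monotone V ∧
      (∀ u v, 0 ≤ u → u ≤ v → V v * u ≤ V u * v) ∧
      ∀ u, 0 ≤ u → V u = min (min (w₀ * u) w₁) (1 + ∫ s, V (u * Real.exp (-s)) ∂ρ) := by
  have hlim : ∀ u, ∃ v, Tendsto (fun n => valueIter ρ w₀ w₁ n u) atTop (𝓝 v) := fun u =>
    ⟨_, tendsto_atTop_ciInf (antitone_nat_of_succ_le fun n => valueIter_succ_le h₀ h₁ n u)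
      ⟨0, by rintro _ ⟨n, rfl⟩; exact valueIter_nonneg h₀ h₁ n u⟩⟩
  choose V hV using hlim
  refine ⟨V, measurable_of_tendsto_metrizable (fun n => measurable_valueIter n)
      (tendsto_pi_nhds.2 hV),
    fun u => ge_of_tendsto' (hV u) fun n => valueIter_nonneg h₀ h₁ n u,
    fun u => le_of_tendsto' (hV u) fun n => valueIter_le n u,
    fun u v huv => le_of_tendsto_of_tendsto' (hV u) (hV v)
      fun n => monotone_valueIter h₀ h₁ n huv,
    fun u v hu huv => le_of_tendsto_of_tendsto' ((hV v).mul_const u) ((hV u).mul_const v)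
      fun n => valueIter_mul_le h₀ h₁ n hu huv, fun u hu => ?_⟩
  have hint : Tendsto (fun n => ∫ s, valueIter ρ w₀ w₁ n (u * Real.exp (-s)) ∂ρ) atTop
      (𝓝 (∫ s, V (u * Real.exp (-s)) ∂ρ)) := by
    refine tendsto_integral_of_dominated_convergence (fun _ => w₁)
      (fun n => (integrable_valueIter h₀ h₁ n u).aestronglyMeasurable)
      (integrable_const _) (fun n => Eventually.of_forall fun s => ?_)
      (Eventually.of_forall fun s => hV _)
    rw [Real.norm_eq_abs, abs_of_nonneg (valueIter_nonneg h₀ h₁ _ _)]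
    exact valueIter_le n _
  have hmin : Tendsto (fun n => valueIter ρ w₀ w₁ (n + 1) u) atTop
      (𝓝 (min (min (w₀ * max u 0) w₁) (1 + ∫ s, V (u * Real.exp (-s)) ∂ρ))) :=
    tendsto_const_nhds.min (tendsto_const_nhds.add hint)
  rw [max_eq_left hu] at hmin
  exact tendsto_nhds_unique ((tendsto_add_atTop_iff_nat 1).2 (hV u)) hmin

end ValueFunction

/-! ### Stopping times with decisions, and optional stopping. -/

section Stopping

variable {Ω : Type*}

/-- The random time `τ` truncated at `N`. -/
def stopAt (τ : Ω → ℕ∞) (N : ℕ) (ω : Ω) : ℕ := (min (τ ω) N).toNat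

lemma stopAt_of_le {τ : Ω → ℕ∞} {N n : ℕ} {ω : Ω} (h : τ ω = n) (hn : n ≤ N) :
    stopAt τ N ω = n := by
  rw [stopAt, h, min_eq_left (by exact_mod_cast hn), ENat.toNat_natCast]

lemma stopAt_of_lt {τ : Ω → ℕ∞} {N : ℕ} {ω : Ω} (h : (N : ℕ∞) ≤ τ ω) :
    stopAt τ N ω = N := by
  rw [stopAt, min_eq_right h, ENat.toNat_natCast]

lemma stopAt_le (τ : Ω → ℕ∞) (N : ℕ) (ω : Ω) : stopAt τ N ω ≤ N := by
  rcases le_total (τ ω) N with h | h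
  · obtain ⟨n, hn⟩ := ENat.ne_top_iff_exists.1 (ne_top_of_le_ne_top (ENat.natCast_ne_top N) h)
    rw [← hn] at h
    rw [stopAt_of_le hn.symm (by exact_mod_cast h)]
    exact_mod_cast h
  · rw [stopAt_of_lt h]

lemma coe_stopAt (τ : Ω → ℕ∞) (N : ℕ) (ω : Ω) : (stopAt τ N ω : ℕ∞) = min (τ ω) N :=
  ENat.natCast_toNat (ne_top_of_le_ne_top (ENat.natCast_ne_top N) (min_le_right _ _))

lemma stopAt_le_self (τ : Ω → ℕ∞) (N : ℕ) (ω : Ω) : (stopAt τ N ω : ℕ∞) ≤ τ ω := by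
  rw [coe_stopAt]; exact min_le_left _ _

/-- Raising the truncation level by one adds an increment only on `{N < τ}`, an event known at time
`N`. This drives the inductions for optional stopping. -/
lemma stopAt_succ (X : ℕ → Ω → ℝ) (τ : Ω → ℕ∞) (N : ℕ) (ω : Ω) :
    X (stopAt τ (N + 1) ω) ω
      = X (stopAt τ N ω) ω + {ω | (N : ℕ∞) < τ ω}.indicator (X (N + 1) - X N) ω := by
  by_cases h : (N : ℕ∞) < τ ω
  · rw [Set.indicator_of_mem (by exact h), stopAt_of_lt h.le,
      stopAt_of_lt (by exact_mod_cast Order.add_one_le_of_lt h)]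
    simp
  · rw [Set.indicator_of_notMem (by exact h), add_zero]
    rw [not_lt] at h
    obtain ⟨n, hn⟩ := ENat.ne_top_iff_exists.1 (ne_top_of_le_ne_top (ENat.natCast_ne_top N) h)
    rw [← hn] at h
    have h' : n ≤ N := by exact_mod_cast h
    rw [stopAt_of_le hn.symm h', stopAt_of_le hn.symm (h'.trans N.le_succ)]

variable {m : MeasurableSpace Ω} {P : Measure Ω} {F : Filtration ℕ m}

/-- `τ` is a stopping time and the decision set `D` is determined by the information at `τ`. -/
structure IsTest (F : Filtration ℕ m) (τ : Ω → ℕ∞) (D : Set Ω) : Prop where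
  meas_eq : ∀ n : ℕ, MeasurableSet[F n] {ω | τ ω = n}
  dec : ∀ n : ℕ, MeasurableSet[F n] (D ∩ {ω | τ ω = n})

lemma IsTest.lt {τ : Ω → ℕ∞} {D : Set Ω} (h : IsTest F τ D) (n : ℕ) :
    MeasurableSet[F n] {ω | (n : ℕ∞) < τ ω} := by
  have : {ω | (n : ℕ∞) < τ ω} = (⋃ k ∈ Finset.range (n + 1), {ω | τ ω = k})ᶜ := by
    ext ω
    simp only [Set.mem_ofPred_eq, Finset.mem_range, Set.mem_compl_iff, Set.mem_iUnion, not_exists]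
    constructor
    · rintro h k hk h'
      rw [h'] at h
      have : n < k := by exact_mod_cast h
      omega
    · intro h'
      by_contra hc
      rw [not_lt] at hc
      obtain ⟨k, hk⟩ := ENat.ne_top_iff_exists.1 (ne_top_of_le_ne_top (ENat.natCast_ne_top n) hc)
      rw [← hk] at hc
      exact h' k (Nat.lt_succ_of_le (by exact_mod_cast hc)) hk.symm
  rw [this]
  refine MeasurableSet.compl (Finset.measurableSet_biUnion _ fun k hk => ?_)
  exact F.mono (Nat.lt_succ_iff.1 (Finset.mem_range.1 hk)) _ (h.meas_eq k)

lemma IsTest.measurable_time {τ : Ω → ℕ∞} {D : Set Ω} (h : IsTest F τ D) : Measurable τ :=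
  measurable_to_countable' fun k => by
    induction k using ENat.recTopCoe with
    | top =>
      have : τ ⁻¹' {⊤} = (⋃ n : ℕ, {ω | τ ω = n})ᶜ := by
        ext ω
        simp only [Set.mem_preimage, Set.mem_singleton_iff, Set.mem_compl_iff, Set.mem_iUnion,
          Set.mem_ofPred_eq, not_exists]
        refine ⟨fun h n => by simp [h], fun h => ?_⟩
        by_contra hc
        obtain ⟨k, hk⟩ := ENat.ne_top_iff_exists.1 hc
        exact h k hk.symm
      rw [this]
      exact (MeasurableSet.iUnion fun n => F.le n _ (h.meas_eq n)).compl
    | coe n => exact F.le n _ (h.meas_eq n)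

lemma IsTest.measurable_stopAt {τ : Ω → ℕ∞} {D : Set Ω} (h : IsTest F τ D) (N : ℕ) :
    Measurable (stopAt τ N) := by
  have : Measurable fun x : ℕ∞ => (min x N).toNat := measurable_from_top
  exact this.comp h.measurable_time

lemma IsTest.integrable_stopped {τ : Ω → ℕ∞} {D : Set Ω} (h : IsTest F τ D)
    {X : ℕ → Ω → ℝ} (hX : ∀ n, Integrable (X n) P) (N : ℕ) :
    Integrable (fun ω => X (stopAt τ N ω) ω) P := by
  induction N with
  | zero =>
    have : (fun ω => X (stopAt τ 0 ω) ω) = X 0 := by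
      funext ω; rw [Nat.le_zero.1 (stopAt_le τ 0 ω)]
    rw [this]; exact hX 0
  | succ N ih =>
    simp only [stopAt_succ]
    exact ih.add (((hX _).sub (hX _)).indicator (F.le N _ (h.lt N)))

/-- Optional stopping at a truncated stopping time. -/
lemma IsTest.integral_le_stopped {τ : Ω → ℕ∞} {D : Set Ω} (h : IsTest F τ D)
    {X : ℕ → Ω → ℝ} (hX : ∀ n, Integrable (X n) P)
    (hle : ∀ n : ℕ, ∫ ω in {ω | (n : ℕ∞) < τ ω}, X n ω ∂P
      ≤ ∫ ω in {ω | (n : ℕ∞) < τ ω}, X (n + 1) ω ∂P) (N : ℕ) :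
    ∫ ω, X 0 ω ∂P ≤ ∫ ω, X (stopAt τ N ω) ω ∂P := by
  induction N with
  | zero =>
    have : (fun ω => X (stopAt τ 0 ω) ω) = X 0 := by
      funext ω; rw [Nat.le_zero.1 (stopAt_le τ 0 ω)]
    rw [this]
  | succ N ih =>
    simp only [stopAt_succ]
    have hm := F.le N _ (h.lt N)
    rw [integral_add (h.integrable_stopped hX N) (((hX _).sub (hX _)).indicator hm),
      integral_indicator hm]
    have := hle N
    simp only [Pi.sub_apply]
    rw [integral_sub (hX _).integrableOn (hX _).integrableOn]
    linarith

lemma IsTest.integral_eq_stopped {τ : Ω → ℕ∞} {D : Set Ω} (h : IsTest F τ D)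
    {X : ℕ → Ω → ℝ} (hX : ∀ n, Integrable (X n) P)
    (heq : ∀ n : ℕ, ∫ ω in {ω | (n : ℕ∞) < τ ω}, X n ω ∂P
      = ∫ ω in {ω | (n : ℕ∞) < τ ω}, X (n + 1) ω ∂P) (N : ℕ) :
    ∫ ω, X 0 ω ∂P = ∫ ω, X (stopAt τ N ω) ω ∂P := by
  refine le_antisymm (h.integral_le_stopped hX (fun n => (heq n).le) N) ?_
  have := h.integral_le_stopped (X := fun n ω => -X n ω) (fun n => (hX n).neg)
    (fun n => by simp only [integral_neg]; rw [heq n]) N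
  simp only [integral_neg] at this
  linarith

lemma stopAt_eventually {τ : Ω → ℕ∞} {ω : Ω} (h : τ ω ≠ ⊤) :
    ∀ᶠ N in atTop, stopAt τ N ω = (τ ω).toNat := by
  obtain ⟨n, hn⟩ := ENat.ne_top_iff_exists.1 h
  filter_upwards [eventually_ge_atTop n] with N hN
  rw [stopAt_of_le hn.symm hN, ← hn, ENat.toNat_natCast]

/-- Bounded convergence for a stopped process. -/
lemma IsTest.tendsto_integral_stopped [IsFiniteMeasure P] {τ : Ω → ℕ∞} {D : Set Ω}
    (h : IsTest F τ D) (hfin : ∀ᵐ ω ∂P, τ ω ≠ ⊤)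
    {X : ℕ → Ω → ℝ} (hX : ∀ n, Integrable (X n) P) {c : ℝ}
    (hc : ∀ᵐ ω ∂P, ∀ N, |X (stopAt τ N ω) ω| ≤ c) :
    Tendsto (fun N => ∫ ω, X (stopAt τ N ω) ω ∂P) atTop
      (𝓝 (∫ ω, X (τ ω).toNat ω ∂P)) := by
  refine tendsto_integral_of_dominated_convergence (fun _ => c)
    (fun N => (h.integrable_stopped hX N).aestronglyMeasurable) (integrable_const c)
    (fun N => ?_) ?_
  · filter_upwards [hc] with ω hω using hω N
  · filter_upwards [hfin] with ω hω
    exact tendsto_const_nhds.congr' ((stopAt_eventually hω).mono fun N hN => by dsimp only; rw [hN])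

lemma IsTest.aestronglyMeasurable_stopped {τ : Ω → ℕ∞} {D : Set Ω}
    (h : IsTest F τ D) (hfin : ∀ᵐ ω ∂P, τ ω ≠ ⊤)
    {X : ℕ → Ω → ℝ} (hX : ∀ n, Integrable (X n) P) :
    AEStronglyMeasurable (fun ω => X (τ ω).toNat ω) P := by
  refine aestronglyMeasurable_of_tendsto_ae atTop
    (fun N => (h.integrable_stopped hX N).aestronglyMeasurable) ?_
  filter_upwards [hfin] with ω hω
  exact tendsto_const_nhds.congr' ((stopAt_eventually hω).mono fun N hN => by dsimp only; rw [hN])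

lemma IsTest.integrable_stopAt [IsFiniteMeasure P] {τ : Ω → ℕ∞} {D : Set Ω} (h : IsTest F τ D)
    (N : ℕ) : Integrable (fun ω => (stopAt τ N ω : ℝ)) P := by
  refine Integrable.of_bound ((measurable_from_top : Measurable fun x : ℕ => (x : ℝ)).comp
      (h.measurable_stopAt N)).aestronglyMeasurable N (Eventually.of_forall fun ω => ?_)
  rw [Real.norm_natCast]
  exact_mod_cast stopAt_le τ N ω

lemma IsTest.ofReal_integral_stopAt [IsFiniteMeasure P] {τ : Ω → ℕ∞} {D : Set Ω}
    (h : IsTest F τ D) (N : ℕ) :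
    ENNReal.ofReal (∫ ω, (stopAt τ N ω : ℝ) ∂P) = ∫⁻ ω, (stopAt τ N ω : ℝ≥0∞) ∂P := by
  rw [ofReal_integral_eq_lintegral_ofReal (h.integrable_stopAt N)
    (Eventually.of_forall fun ω => by positivity)]
  simp

/-- If the truncated expectations along multiples of `T` are bounded, so is the expectation. -/
lemma IsTest.expectedTime_le [IsFiniteMeasure P] {τ : Ω → ℕ∞} {D : Set Ω} (h : IsTest F τ D)
    {T : ℕ} (hT : 1 ≤ T) {c : ℝ} (hc : ∀ N, ∫ ω, (stopAt τ (T * N) ω : ℝ) ∂P ≤ c) :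
    expectedTime P τ ≤ ENNReal.ofReal c := by
  have hm : ∀ N, Measurable (fun ω => (stopAt τ N ω : ℝ≥0∞)) := fun N =>
    measurable_from_top.comp (h.measurable_stopAt N)
  -- Multiples of `T` suffice for monotone convergence, and they are the only times at which a
  -- quantized statistic controls the walk.
  have hsup : ∀ ω, ((τ ω : ℕ∞) : ℝ≥0∞) = ⨆ N : ℕ, (stopAt τ (T * N) ω : ℝ≥0∞) := by
    intro ω
    refine le_antisymm ?_ (iSup_le fun N => ?_)
    · by_cases hω : τ ω = ⊤
      · rw [hω, ENat.toENNReal_top, top_le_iff]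
        refine ENNReal.eq_top_of_forall_nnreal_le fun r => ?_
        obtain ⟨n, hn⟩ := exists_nat_ge r
        refine le_iSup_of_le n ?_
        rw [stopAt_of_lt (by rw [hω]; exact le_top)]
        have : r ≤ ((T * n : ℕ) : NNReal) := hn.trans (by
          exact_mod_cast Nat.le_mul_of_pos_left n hT)
        exact_mod_cast this
      · obtain ⟨n, hn⟩ := ENat.ne_top_iff_exists.1 hω
        refine le_iSup_of_le n ?_
        rw [stopAt_of_le hn.symm (Nat.le_mul_of_pos_left n hT), ← hn]
        simp
    · have := stopAt_le_self τ (T * N) ω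
      rw [← ENat.toENNReal_le] at this
      simpa using this
  unfold expectedTime
  simp_rw [hsup]
  rw [lintegral_iSup (fun N => hm _)]
  · refine iSup_le fun N => ?_
    rw [← h.ofReal_integral_stopAt]
    exact ENNReal.ofReal_le_ofReal (hc N)
  · intro N M hNM ω
    have : (stopAt τ (T * N) ω : ℕ∞) ≤ stopAt τ (T * M) ω := by
      rw [coe_stopAt, coe_stopAt]
      exact min_le_min_left _ (by exact_mod_cast Nat.mul_le_mul_left T hNM)
    have : stopAt τ (T * N) ω ≤ stopAt τ (T * M) ω := by exact_mod_cast this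
    dsimp only
    exact_mod_cast this

lemma ne_top_of_expectedTime {τ : Ω → ℕ∞} (hm : Measurable τ) (h : expectedTime P τ ≠ ⊤) :
    ∀ᵐ ω ∂P, τ ω ≠ ⊤ := by
  have hm' : Measurable fun ω => ((τ ω : ℕ∞) : ℝ≥0∞) := measurable_from_top.comp hm
  filter_upwards [ae_lt_top hm' h] with ω hω hτ
  rw [hτ] at hω
  simp at hω

lemma expectedTime_eq_integral {τ : Ω → ℕ∞} (hm : Measurable τ) (h : expectedTime P τ ≠ ⊤) :
    Integrable (fun ω => ((τ ω).toNat : ℝ)) P ∧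
      (expectedTime P τ).toReal = ∫ ω, ((τ ω).toNat : ℝ) ∂P := by
  have hfin := ne_top_of_expectedTime hm h
  have hm' : Measurable fun ω => ((τ ω).toNat : ℝ) :=
    (measurable_from_top : Measurable fun x : ℕ∞ => (x.toNat : ℝ)).comp hm
  have he : ∫⁻ ω, ENNReal.ofReal ((τ ω).toNat : ℝ) ∂P = expectedTime P τ := by
    refine lintegral_congr_ae ?_
    filter_upwards [hfin] with ω hω
    obtain ⟨n, hn⟩ := ENat.ne_top_iff_exists.1 hω
    rw [← hn]; simp
  constructor
  · refine ⟨hm'.aestronglyMeasurable, ?_⟩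
    rw [hasFiniteIntegral_iff_ofReal (Eventually.of_forall fun ω => by positivity), he]
    exact h.lt_top
  · rw [integral_eq_lintegral_of_nonneg_ae (Eventually.of_forall fun ω => by positivity)
      hm'.aestronglyMeasurable, he]

lemma IsTest.tendsto_integral_stopAt {τ : Ω → ℕ∞} {D : Set Ω} (h : IsTest F τ D)
    (hfin : expectedTime P τ ≠ ⊤) :
    Tendsto (fun N => ∫ ω, (stopAt τ N ω : ℝ) ∂P) atTop (𝓝 (∫ ω, ((τ ω).toNat : ℝ) ∂P)) := by
  have hf := ne_top_of_expectedTime h.measurable_time hfin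
  refine tendsto_integral_of_dominated_convergence (fun ω => ((τ ω).toNat : ℝ))
    (fun N => ?_) (expectedTime_eq_integral h.measurable_time hfin).1 (fun N => ?_) ?_
  · exact ((measurable_from_top : Measurable fun x : ℕ => (x : ℝ)).comp
      (h.measurable_stopAt N)).aestronglyMeasurable
  · filter_upwards [hf] with ω hω
    obtain ⟨n, hn⟩ := ENat.ne_top_iff_exists.1 hω
    have := stopAt_le_self τ N ω
    rw [← hn] at this ⊢
    simp only [ENat.toNat_natCast, Real.norm_natCast]
    exact_mod_cast this
  · filter_upwards [hf] with ω hω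
    exact tendsto_const_nhds.congr' ((stopAt_eventually hω).mono fun N hN => by dsimp only; rw [hN])

end Stopping

/-! ### First exit from an interval. -/

section ExitTime

variable {Ω : Type*} {Z : ℕ → Ω → ℝ} {A B : ℝ} {ω : Ω} {n : ℕ}

lemma exitTime_eq_iff : exitTime Z A B ω = n ↔
    1 ≤ n ∧ Z n ω ∉ Set.Ioo (-B) A ∧ ∀ j, 1 ≤ j → j < n → Z j ω ∈ Set.Ioo (-B) A := by
  classical
  have hdef : exitTime Z A B ω = if ∃ j, 1 ≤ j ∧ Z j ω ∈ (Set.Ioo (-B) A)ᶜ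
      then ((sInf {i : ℕ | 1 ≤ i ∧ Z i ω ∈ (Set.Ioo (-B) A)ᶜ} : ℕ) : ℕ∞) else ⊤ := by
    unfold exitTime
    rw [hittingAfter_def]
    rfl
  rw [hdef]
  constructor
  · intro h
    split_ifs at h with hex
    · have hn : sInf {i : ℕ | 1 ≤ i ∧ Z i ω ∈ (Set.Ioo (-B) A)ᶜ} = n := by exact_mod_cast h
      have hmem := Nat.sInf_mem (s := {i : ℕ | 1 ≤ i ∧ Z i ω ∈ (Set.Ioo (-B) A)ᶜ}) hex
      rw [hn] at hmem
      refine ⟨hmem.1, hmem.2, fun j hj hjn => ?_⟩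
      rw [← hn] at hjn
      have := Nat.notMem_of_lt_sInf hjn
      by_contra hc
      exact this ⟨hj, hc⟩
    · simp at h
  · rintro ⟨h1, h2, h3⟩
    rw [if_pos ⟨n, h1, h2⟩]
    have hle := Nat.sInf_le (s := {i : ℕ | 1 ≤ i ∧ Z i ω ∈ (Set.Ioo (-B) A)ᶜ}) ⟨h1, h2⟩
    have hmem := Nat.sInf_mem (s := {i : ℕ | 1 ≤ i ∧ Z i ω ∈ (Set.Ioo (-B) A)ᶜ}) ⟨n, h1, h2⟩
    congr 1
    refine le_antisymm hle ?_
    by_contra hc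
    exact hmem.2 (h3 _ hmem.1 (not_le.1 hc))

lemma mem_Ioo_of_lt_exitTime (h : (n : ℕ∞) < exitTime Z A B ω) (hn : 1 ≤ n) :
    Z n ω ∈ Set.Ioo (-B) A := by
  have := notMem_of_lt_hittingAfter (u := Z) (s := (Set.Ioo (-B) A)ᶜ) (n := 1) (ω := ω) h hn
  simpa using this

/-- The reflection `x ↦ -x` maps `(-B, A)` to `(-A, B)`. This symmetry transfers the result from
`H₁` to `H₀`. -/
lemma exitTime_neg (Z : ℕ → Ω → ℝ) (A B : ℝ) :
    exitTime (fun n ω => -Z n ω) B A = exitTime Z A B := by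
  funext ω
  have hiff : ∀ n : ℕ, exitTime (fun n ω => -Z n ω) B A ω = n ↔ exitTime Z A B ω = n := by
    intro n
    have h : ∀ x : ℝ, -x ∈ Set.Ioo (-A) B ↔ x ∈ Set.Ioo (-B) A := fun x => by
      simp only [Set.mem_Ioo]; constructor <;> rintro ⟨h1, h2⟩ <;> constructor <;> linarith
    simp only [exitTime_eq_iff, h]
  by_cases h : exitTime Z A B ω = ⊤
  · rw [h]
    by_contra hc
    obtain ⟨n, hn⟩ := ENat.ne_top_iff_exists.1 hc
    rw [(hiff n).1 hn.symm] at h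
    exact ENat.natCast_ne_top n h
  · obtain ⟨n, hn⟩ := ENat.ne_top_iff_exists.1 h
    rw [← hn, hiff n, hn]

lemma decideOne_neg (Z : ℕ → Ω → ℝ) (A B : ℝ) :
    decideOne (fun n ω => -Z n ω) B A = decideZero Z A B := by
  ext ω
  simp only [decideOne, decideZero, exitTime_neg, Set.mem_ofPred_eq, le_neg]

lemma decideZero_neg (Z : ℕ → Ω → ℝ) (A B : ℝ) :
    decideZero (fun n ω => -Z n ω) B A = decideOne Z A B := by
  ext ω
  simp only [decideOne, decideZero, exitTime_neg, Set.mem_ofPred_eq, neg_le_neg_iff]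

lemma decideOne_inter_eq (Z : ℕ → Ω → ℝ) (A B : ℝ) (n : ℕ) :
    decideOne Z A B ∩ {ω | exitTime Z A B ω = n}
      = {ω | A ≤ Z n ω} ∩ {ω | exitTime Z A B ω = n} := by
  ext ω
  simp only [decideOne, Set.mem_inter_iff, Set.mem_ofPred_eq]
  constructor
  · rintro ⟨⟨k, hk, hA⟩, hn⟩
    rw [hn] at hk
    have : n = k := by exact_mod_cast hk
    exact ⟨this ▸ hA, hn⟩
  · rintro ⟨hA, hn⟩
    exact ⟨⟨n, hn, hA⟩, hn⟩

/-- If the test stops, exactly one of the two decisions is taken. -/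
lemma mem_decideZero_iff (hAB : -B < A) (h : exitTime Z A B ω ≠ ⊤) :
    ω ∈ decideZero Z A B ↔ ω ∉ decideOne Z A B := by
  obtain ⟨n, hn⟩ := ENat.ne_top_iff_exists.1 h
  have hnot := (exitTime_eq_iff.1 hn.symm).2.1
  simp only [Set.mem_Ioo, not_and_or, not_lt] at hnot
  have h1 : ω ∈ decideOne Z A B ↔ A ≤ Z n ω := by
    constructor
    · rintro ⟨k, hk, hA⟩
      rw [← hn] at hk
      have : n = k := by exact_mod_cast hk
      exact this ▸ hA
    · exact fun hA => ⟨n, hn.symm, hA⟩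
  have h0 : ω ∈ decideZero Z A B ↔ Z n ω ≤ -B := by
    constructor
    · rintro ⟨k, hk, hA⟩
      rw [← hn] at hk
      have : n = k := by exact_mod_cast hk
      exact this ▸ hA
    · exact fun hA => ⟨n, hn.symm, hA⟩
  rw [h1, h0, not_le]
  constructor
  · intro h; linarith
  · intro h; rcases hnot with h' | h'
    · exact h'
    · linarith

variable {m : MeasurableSpace Ω} {F : Filtration ℕ m}

lemma measurableSet_exitTime_eq (hZ : ∀ n, Measurable[F n] (Z n)) (A B : ℝ) (n : ℕ) :
    MeasurableSet[F n] {ω | exitTime Z A B ω = n} := by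
  have hs : {ω | exitTime Z A B ω = n} = {_ω : Ω | 1 ≤ n} ∩ ((Z n ⁻¹' (Set.Ioo (-B) A)ᶜ) ∩
      ⋂ j ∈ Finset.Ico 1 n, Z j ⁻¹' (Set.Ioo (-B) A)) := by
    ext ω
    simp only [Set.mem_ofPred_eq, exitTime_eq_iff, Set.mem_inter_iff, Set.mem_preimage,
      Set.mem_compl_iff, Set.mem_iInter, Finset.mem_Ico, and_imp]
  rw [hs]
  refine MeasurableSet.inter (MeasurableSet.const _) (MeasurableSet.inter
    (hZ n measurableSet_Ioo.compl) (Finset.measurableSet_biInter _ fun j hj => ?_))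
  exact F.mono (Finset.mem_Ico.1 hj).2.le _ (hZ j measurableSet_Ioo)

lemma isTest_exitTime (hZ : ∀ n, Measurable[F n] (Z n)) (A B : ℝ) :
    IsTest F (exitTime Z A B) (decideOne Z A B) where
  meas_eq := measurableSet_exitTime_eq hZ A B
  dec n := by
    rw [decideOne_inter_eq]
    exact (hZ n measurableSet_Ici).inter (measurableSet_exitTime_eq hZ A B n)

lemma measurableSet_decideOne (hZ : ∀ n, Measurable (Z n)) (A B : ℝ) :
    MeasurableSet (decideOne Z A B) := by
  -- For the constant filtration, adaptedness is plain measurability.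
  have hF : ∀ n, Measurable[(Filtration.const ℕ m le_rfl) n] (Z n) := hZ
  have : decideOne Z A B = ⋃ n : ℕ, decideOne Z A B ∩ {ω | exitTime Z A B ω = n} := by
    ext ω
    simp only [Set.mem_iUnion, Set.mem_inter_iff, Set.mem_ofPred_eq]
    exact ⟨fun h => ⟨h.choose, h, h.choose_spec.1⟩, fun ⟨_, h, _⟩ => h⟩
  rw [this]
  exact MeasurableSet.iUnion fun n => (isTest_exitTime hF A B).dec n

end ExitTime

/-! ### The log-likelihood random walk and Wald's identity. -/

section Model

variable {Ω : Type*}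

/-- The random walk with increments `l`. -/
def walk (l : ℕ → Ω → ℝ) (n : ℕ) (ω : Ω) : ℝ := ∑ i ∈ Finset.range n, l i ω

@[simp] lemma walk_zero (l : ℕ → Ω → ℝ) (ω : Ω) : walk l 0 ω = 0 := by simp [walk]

lemma walk_succ (l : ℕ → Ω → ℝ) (n : ℕ) (ω : Ω) : walk l (n + 1) ω = walk l n ω + l n ω :=
  Finset.sum_range_succ _ _

lemma abs_walk_le {l : ℕ → Ω → ℝ} {b : ℝ} {ω : Ω} (h : ∀ n, |l n ω| ≤ b) (n : ℕ) :
    |walk l n ω| ≤ n * b := by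
  refine (Finset.abs_sum_le_sum_abs _ _).trans ((Finset.sum_le_sum fun i _ => h i).trans ?_)
  simp

/-- Under `P` the increments `l` are bounded, independent and identically distributed, and the walk
is the log-likelihood ratio of `P` against `Q` on the observations in `F`. -/
structure LLRModel {m : MeasurableSpace Ω} (P Q : Measure Ω) (F : Filtration ℕ m)
    (l : ℕ → Ω → ℝ) (b : ℝ) : Prop where
  adapted : ∀ n, Measurable[F (n + 1)] (l n)
  indep : ∀ n, Indep (MeasurableSpace.comap (l n) inferInstance) (F n) P
  ident : ∀ n, P.map (l n) = P.map (l 0)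
  bound : ∀ n, ∀ᵐ ω ∂P, |l n ω| ≤ b
  density : ∀ n G, MeasurableSet[F n] G → Q.real G = ∫ ω in G, Real.exp (-walk l n ω) ∂P

variable {m : MeasurableSpace Ω} {P Q : Measure Ω} {F : Filtration ℕ m} {l : ℕ → Ω → ℝ} {b : ℝ}

namespace LLRModel

lemma measurable_inc (M : LLRModel P Q F l b) (n : ℕ) : Measurable (l n) :=
  (M.adapted n).mono (F.le _) le_rfl

lemma measurable_walk (M : LLRModel P Q F l b) (n : ℕ) : Measurable[F n] (walk l n) := by
  refine Finset.measurable_sum _ fun i hi => ?_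
  exact (M.adapted i).mono (F.mono (Finset.mem_range.1 hi)) le_rfl

lemma measurable_walk' (M : LLRModel P Q F l b) (n : ℕ) : Measurable (walk l n) :=
  (M.measurable_walk n).mono (F.le _) le_rfl

lemma ae_bound (M : LLRModel P Q F l b) : ∀ᵐ ω ∂P, ∀ n, |l n ω| ≤ b :=
  ae_all_iff.2 M.bound

lemma integral_law (M : LLRModel P Q F l b) {h : ℝ → ℝ} (hh : Measurable h) :
    ∫ s, h s ∂(P.map (l 0)) = ∫ ω, h (l 0 ω) ∂P :=
  integral_map (M.measurable_inc 0).aemeasurable hh.aestronglyMeasurable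

variable [IsProbabilityMeasure P]

lemma bound_nonneg (M : LLRModel P Q F l b) : 0 ≤ b := by
  obtain ⟨ω, hω⟩ := M.ae_bound.exists
  exact (abs_nonneg _).trans (hω 0)

lemma isProbabilityMeasure_law (M : LLRModel P Q F l b) : IsProbabilityMeasure (P.map (l 0)) :=
  Measure.isProbabilityMeasure_map (M.measurable_inc 0).aemeasurable

lemma integrable_comp (M : LLRModel P Q F l b) {h : ℝ → ℝ} (hh : Continuous h) (n : ℕ) :
    Integrable (fun ω => h (walk l n ω)) P := by
  obtain ⟨c, hc⟩ := (isCompact_Icc (a := -(n * b)) (b := n * b)).exists_bound_of_continuousOn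
    hh.continuousOn
  refine Integrable.of_bound (hh.measurable.comp (M.measurable_walk' n)).aestronglyMeasurable c ?_
  filter_upwards [M.ae_bound] with ω hω
  exact hc _ (abs_le.1 (abs_walk_le hω n))

lemma integrable_comp_inc (M : LLRModel P Q F l b) {h : ℝ → ℝ} (hh : Continuous h) (n : ℕ) :
    Integrable (fun ω => h (l n ω)) P := by
  obtain ⟨c, hc⟩ := (isCompact_Icc (a := -b) (b := b)).exists_bound_of_continuousOn
    hh.continuousOn
  refine Integrable.of_bound (hh.measurable.comp (M.measurable_inc n)).aestronglyMeasurable c ?_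
  filter_upwards [M.ae_bound] with ω hω
  exact hc _ (abs_le.1 (hω n))

/-- Integration over the increment `l n`, which is independent of the past. -/
lemma setIntegral_step (M : LLRModel P Q F l b) (n : ℕ) {G : Set Ω} (hG : MeasurableSet[F n] G)
    {g : Ω → ℝ} (hg : Measurable[F n] g) {h : ℝ → ℝ → ℝ} (hh : Measurable (Function.uncurry h))
    (hint : Integrable (fun ω => h (g ω) (l n ω)) P) :
    ∫ ω in G, h (g ω) (l n ω) ∂P = ∫ ω in G, (∫ s, h (g ω) s ∂(P.map (l 0))) ∂P := by
  have := M.isProbabilityMeasure_law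
  set ρ := P.map (l 0)
  have hGm : MeasurableSet G := F.le n _ hG
  let X : Ω → ℝ × ℝ := fun ω => (G.indicator (fun _ => (1 : ℝ)) ω, g ω)
  have hXF : Measurable[F n] X :=
    (Measurable.indicator (m := F n) measurable_const hG).prodMk hg
  have hX : Measurable X := hXF.mono (F.le n) le_rfl
  have hl := M.measurable_inc n
  have hind : IndepFun X (l n) P := by
    rw [IndepFun_iff_Indep]
    exact (indep_of_indep_of_le_right (M.indep n) hXF.comap_le).symm
  have hlaw : P.map (fun ω => (X ω, l n ω)) = (P.map X).prod ρ := by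
    rw [(indepFun_iff_map_prod_eq_prod_map_map hX.aemeasurable hl.aemeasurable).1 hind, M.ident n]
  let H : (ℝ × ℝ) × ℝ → ℝ := fun p => p.1.1 * h p.1.2 p.2
  have hH : Measurable H := by
    refine (measurable_fst.fst).mul (hh.comp ((measurable_fst.snd).prodMk measurable_snd))
  have hXl : Measurable fun ω => (X ω, l n ω) := hX.prodMk hl
  have hHX : ∀ ω, H (X ω, l n ω) = G.indicator (fun ω => h (g ω) (l n ω)) ω := by
    intro ω
    by_cases hω : ω ∈ G <;> simp [H, X, hω]
  have hHint : Integrable H ((P.map X).prod ρ) := by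
    rw [← hlaw, integrable_map_measure hH.aestronglyMeasurable hXl.aemeasurable]
    refine (hint.indicator hGm).congr (Eventually.of_forall fun ω => (hHX ω).symm)
  have hsm : Measurable fun x : ℝ × ℝ => ∫ s, H (x, s) ∂ρ :=
    (hH.stronglyMeasurable.integral_prod_right).measurable
  calc ∫ ω in G, h (g ω) (l n ω) ∂P = ∫ ω, H (X ω, l n ω) ∂P := by
        rw [← integral_indicator hGm]
        exact integral_congr_ae (Eventually.of_forall fun ω => (hHX ω).symm)
    _ = ∫ p, H p ∂((P.map X).prod ρ) := by
        rw [← hlaw, integral_map hXl.aemeasurable hH.aestronglyMeasurable]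
    _ = ∫ x, ∫ s, H (x, s) ∂ρ ∂(P.map X) := integral_prod _ hHint
    _ = ∫ ω, ∫ s, H (X ω, s) ∂ρ ∂P :=
        integral_map hX.aemeasurable hsm.aestronglyMeasurable
    _ = ∫ ω in G, (∫ s, h (g ω) s ∂ρ) ∂P := by
        rw [← integral_indicator hGm]
        refine integral_congr_ae (Eventually.of_forall fun ω => ?_)
        by_cases hω : ω ∈ G <;> simp [H, X, hω]

/-- Wald's identity at a truncated stopping time. -/
lemma integral_walk_stopAt (M : LLRModel P Q F l b) {τ : Ω → ℕ∞} {D : Set Ω} (h : IsTest F τ D)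
    (N : ℕ) : ∫ ω, walk l (stopAt τ N ω) ω ∂P
      = (∫ ω, l 0 ω ∂P) * ∫ ω, (stopAt τ N ω : ℝ) ∂P := by
  set μ := ∫ ω, l 0 ω ∂P with hμ
  have hXi : ∀ n, Integrable (fun ω => walk l n ω - n * μ) P := fun n =>
    (M.integrable_comp continuous_id n).sub (integrable_const _)
  -- The compensated walk is a martingale.
  have key := h.integral_eq_stopped (X := fun n ω => walk l n ω - n * μ) hXi (fun n => by
    have hli : Integrable (fun ω => l n ω) P := M.integrable_comp_inc continuous_id n
    have hls : Integrable (fun ω => l n ω - μ) P := hli.sub (integrable_const μ)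
    have h1 : ∀ ω, walk l (n + 1) ω - ((n + 1 : ℕ) : ℝ) * μ
        = (walk l n ω - n * μ) + (l n ω - μ) := fun ω => by rw [walk_succ]; push_cast; ring
    simp only [h1]
    rw [integral_add (hXi n).integrableOn hls.integrableOn,
      integral_sub hli.integrableOn (integrable_const μ).integrableOn]
    have h2 := M.setIntegral_step n (h.lt n) (g := fun _ => 0) measurable_const
      (h := fun _ s => s) (by simpa [Function.uncurry_def] using measurable_snd) hli
    have h3 := M.integral_law measurable_id
    simp only [id] at h3
    rw [h3, ← hμ] at h2
    rw [h2]; ring) N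
  simp only [walk_zero, Nat.cast_zero, zero_mul, sub_zero, integral_zero] at key
  have hi := h.integrable_stopAt (P := P) N
  have hw : Integrable (fun ω => walk l (stopAt τ N ω) ω) P :=
    h.integrable_stopped (fun n => M.integrable_comp continuous_id n) N
  rw [integral_sub hw (hi.mul_const μ), integral_mul_const] at key
  linarith

/-- By Wald's identity the mean of `walk - δ τ` at a truncated time is `μ - δ` times the mean of
that time. The slack `δ` will absorb the quantization error. -/
lemma expectedTime_le (M : LLRModel P Q F l b) {τ : Ω → ℕ∞} {D : Set Ω} (h : IsTest F τ D)
    {T : ℕ} (hT : 1 ≤ T) {δ c : ℝ} (hδ : δ < ∫ ω, l 0 ω ∂P)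
    (hc : ∀ᵐ ω ∂P, ∀ N, walk l (stopAt τ (T * N) ω) ω - δ * stopAt τ (T * N) ω ≤ c) :
    expectedTime P τ ≤ ENNReal.ofReal (c / ((∫ ω, l 0 ω ∂P) - δ)) := by
  refine h.expectedTime_le hT fun N => ?_
  rw [le_div_iff₀ (by linarith)]
  have hi := h.integrable_stopAt (P := P) (T * N)
  have hw : Integrable (fun ω => walk l (stopAt τ (T * N) ω) ω) P :=
    h.integrable_stopped (fun n => M.integrable_comp continuous_id n) _
  have := integral_mono_ae (hw.sub (hi.const_mul δ)) (integrable_const c)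
    (by filter_upwards [hc] with ω hω using hω N)
  simp only [Pi.sub_apply] at this
  rw [integral_sub hw (hi.const_mul δ), integral_const_mul, M.integral_walk_stopAt h] at this
  simp only [integral_const, probReal_univ, one_smul] at this
  linarith

/-- The increments have mean zero only if they vanish; otherwise the drift is positive. -/
lemma drift_pos (M : LLRModel P Q F l b) [IsProbabilityMeasure Q]
    (h0 : ¬ l 0 =ᵐ[P] 0) : 0 < ∫ ω, l 0 ω ∂P := by
  -- Total mass one of `Q` means that `exp (-l 0)` has mean 1, so the mean of `l 0` equals that of
  -- the nonnegative `exp (-l 0) - 1 + l 0`, which vanishes only where `l 0 = 0`.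
  have hd := M.density 1 Set.univ MeasurableSet.univ
  simp only [walk, Finset.sum_range_one, Measure.restrict_univ, probReal_univ] at hd
  have hl : Integrable (fun ω => l 0 ω) P := M.integrable_comp_inc continuous_id 0
  have he : Integrable (fun ω => Real.exp (-l 0 ω)) P :=
    M.integrable_comp_inc (h := fun x => Real.exp (-x)) (by fun_prop) 0
  have he1 : Integrable (fun ω => Real.exp (-l 0 ω) - 1) P := he.sub (integrable_const 1)
  have hfun : Integrable (fun ω => Real.exp (-l 0 ω) - 1 + l 0 ω) P :=
    he1.add hl
  have hnn : ∀ ω, 0 ≤ Real.exp (-l 0 ω) - 1 + l 0 ω := fun ω => by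
    have := Real.add_one_le_exp (-l 0 ω); linarith
  have hi : ∫ ω, (Real.exp (-l 0 ω) - 1 + l 0 ω) ∂P = ∫ ω, l 0 ω ∂P := by
    rw [integral_add he1 hl, integral_sub he (integrable_const 1), ← hd]
    simp
  rw [← hi]
  refine lt_of_le_of_ne (integral_nonneg hnn) fun hz => h0 ?_
  have := (integral_eq_zero_iff_of_nonneg hnn hfun).1 hz.symm
  filter_upwards [this] with ω hω
  by_contra hne
  have := Real.add_one_lt_exp (x := -l 0 ω) (by simpa using hne)
  simp only [Pi.zero_apply] at hω
  linarith

end LLRModel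

end Model

/-! ### Exit of the shifted walk and change of measure at stopping times. -/

section Optimality

variable {Ω : Type*} {m : MeasurableSpace Ω} {P Q : Measure Ω} {F : Filtration ℕ m}
  {l : ℕ → Ω → ℝ} {b : ℝ}

lemma IsTest.compl {τ : Ω → ℕ∞} {D : Set Ω} (h : IsTest F τ D) : IsTest F τ Dᶜ where
  meas_eq := h.meas_eq
  dec n := by
    have : Dᶜ ∩ {ω | τ ω = n} = {ω | τ ω = n} \ (D ∩ {ω | τ ω = n}) := by
      ext ω; simp only [Set.mem_inter_iff, Set.mem_compl_iff, Set.mem_sdiff]; tauto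
    rw [this]
    exact (h.meas_eq n).diff (h.dec n)

lemma IsTest.inter_ne_top {τ : Ω → ℕ∞} (D : Set Ω) :
    D ∩ {ω | τ ω ≠ ⊤} = ⋃ n : ℕ, D ∩ {ω | τ ω = n} := by
  ext ω
  simp only [Set.mem_inter_iff, Set.mem_ofPred_eq, Set.mem_iUnion, exists_and_left]
  refine and_congr_right fun _ => ⟨fun h => ?_, fun ⟨n, hn⟩ => by rw [hn]; simp⟩
  obtain ⟨n, hn⟩ := ENat.ne_top_iff_exists.1 h
  exact ⟨n, hn.symm⟩

/-- A test says nothing about `D` on `{τ = ⊤}`, where `D` need not be measurable; hence the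
restriction to finite times, here and below. -/
lemma IsTest.measurableSet_inter {τ : Ω → ℕ∞} {D : Set Ω} (h : IsTest F τ D) :
    MeasurableSet (D ∩ {ω | τ ω ≠ ⊤}) := by
  rw [IsTest.inter_ne_top]
  exact MeasurableSet.iUnion fun n => F.le n _ (h.dec n)

namespace LLRModel

variable {A B x : ℝ}

/-- The first exit of the walk started at `x` from the interval `(-B, A)`. -/
lemma isTest_exit (M : LLRModel P Q F l b) (A B x : ℝ) :
    IsTest F (exitTime (fun n ω => x + walk l n ω) A B)
      (decideOne (fun n ω => x + walk l n ω) A B) :=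
  isTest_exitTime (fun n => (M.measurable_walk n).const_add x) A B

/-- One step before a positive stopping index the walk is still in the closed interval, and a jump
adds at most `b`. Since exits count from index 1, the start may be an endpoint, as the optimality
proof requires. -/
lemma abs_exit_le (hx : x ∈ Set.Icc (-B) A) {ω : Ω} (hb : ∀ n, |l n ω| ≤ b) (N : ℕ) :
    -B - b ≤ x + walk l (stopAt (exitTime (fun n ω => x + walk l n ω) A B) N ω) ω ∧
      x + walk l (stopAt (exitTime (fun n ω => x + walk l n ω) A B) N ω) ω ≤ A + b := by
  have hb0 := (abs_nonneg _).trans (hb 0)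
  set τ := exitTime (fun n ω => x + walk l n ω) A B with hτ
  cases hk : stopAt τ N ω with
  | zero =>
    rw [walk_zero]
    exact ⟨by linarith [hx.1], by linarith [hx.2]⟩
  | succ j =>
    have h1 := stopAt_le_self τ N ω
    rw [hk] at h1
    have h2 : (j : ℕ∞) < τ ω := lt_of_lt_of_le (by exact_mod_cast Nat.lt_succ_self j) h1
    have h3 : x + walk l j ω ∈ Set.Icc (-B) A := by
      rcases Nat.eq_zero_or_pos j with rfl | hj
      · simpa using hx
      · exact Set.Ioo_subset_Icc_self (mem_Ioo_of_lt_exitTime h2 hj)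
    have := abs_le.1 (hb j)
    rw [walk_succ]
    exact ⟨by linarith [h3.1], by linarith [h3.2]⟩

variable [IsProbabilityMeasure P] [IsProbabilityMeasure Q]

/-- Change of measure at a stopping time. -/
lemma stopped_density (M : LLRModel P Q F l b) {τ : Ω → ℕ∞} {D : Set Ω} (h : IsTest F τ D) :
    IntegrableOn (fun ω => Real.exp (-walk l (τ ω).toNat ω)) (D ∩ {ω | τ ω ≠ ⊤}) P ∧
      ∫ ω in D ∩ {ω | τ ω ≠ ⊤}, Real.exp (-walk l (τ ω).toNat ω) ∂P
        = Q.real (D ∩ {ω | τ ω ≠ ⊤}) := by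
  set E := D ∩ {ω | τ ω ≠ ⊤} with hE
  have hEm : MeasurableSet E := h.measurableSet_inter
  have hdm : ∀ n : ℕ, MeasurableSet (D ∩ {ω | τ ω = n}) := fun n => F.le n _ (h.dec n)
  have hdisj : Pairwise (Function.onFun Disjoint fun n : ℕ => D ∩ {ω | τ ω = n}) := by
    intro i j hij
    refine Set.disjoint_left.2 fun ω hi hj => hij ?_
    have h1 : τ ω = i := hi.2
    have h2 : τ ω = j := hj.2
    rw [h1] at h2
    exact_mod_cast h2
  -- The density identity at each fixed `n` is summed over the disjoint events `{τ = n}`; the lower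
  -- integral makes this possible before integrability is known.
  have hl : ∫⁻ ω in E, ENNReal.ofReal (Real.exp (-walk l (τ ω).toNat ω)) ∂P = Q E := by
    rw [hE, IsTest.inter_ne_top, lintegral_iUnion hdm hdisj, measure_iUnion hdisj hdm]
    congr 1
    funext n
    have h1 : ∫⁻ ω in D ∩ {ω | τ ω = n}, ENNReal.ofReal (Real.exp (-walk l (τ ω).toNat ω)) ∂P
        = ∫⁻ ω in D ∩ {ω | τ ω = n}, ENNReal.ofReal (Real.exp (-walk l n ω)) ∂P := by
      refine setLIntegral_congr_fun (hdm n) fun ω hω => ?_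
      have : τ ω = n := hω.2
      simp [this]
    have hi : Integrable (fun ω => Real.exp (-walk l n ω)) P :=
      M.integrable_comp (h := fun x => Real.exp (-x)) (by fun_prop) n
    rw [h1, ← ofReal_integral_eq_lintegral_ofReal hi.integrableOn
      (Eventually.of_forall fun ω => (Real.exp_pos _).le), ← M.density n _ (h.dec n)]
    simp
  have hm : AEStronglyMeasurable (fun ω => Real.exp (-walk l (τ ω).toNat ω)) (P.restrict E) := by
    refine Measurable.aestronglyMeasurable (Measurable.exp (Measurable.neg ?_))
    have hn : Measurable fun ω => (τ ω).toNat :=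
      (measurable_from_top : Measurable fun x : ℕ∞ => x.toNat).comp h.measurable_time
    exact (measurable_from_prod_countable_right (f := fun p : ℕ × Ω => walk l p.1 p.2)
      fun n => M.measurable_walk' n).comp (hn.prodMk measurable_id)
  constructor
  · refine ⟨hm, ?_⟩
    rw [hasFiniteIntegral_iff_ofReal (Eventually.of_forall fun ω => (Real.exp_pos _).le), hl]
    exact measure_lt_top _ _
  · rw [integral_eq_lintegral_of_nonneg_ae (Eventually.of_forall fun ω => (Real.exp_pos _).le) hm,
      hl]
    rfl

omit [IsProbabilityMeasure Q] in
lemma expectedTime_exit_ne_top (M : LLRModel P Q F l b) (hμ : 0 < ∫ ω, l 0 ω ∂P)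
    (hx : x ∈ Set.Icc (-B) A) :
    expectedTime P (exitTime (fun n ω => x + walk l n ω) A B) ≠ ⊤ := by
  refine ne_top_of_le_ne_top ENNReal.ofReal_ne_top
    (M.expectedTime_le (M.isTest_exit A B x) le_rfl hμ (c := A + b - x) ?_)
  filter_upwards [M.ae_bound] with ω hω N
  have := (abs_exit_le hx hω (1 * N)).2
  linarith

omit [IsProbabilityMeasure Q] in
/-- Almost sure and mean properties of the exit of the walk started at `x` from `(-B, A)`. -/
lemma exit_facts (M : LLRModel P Q F l b) (hμ : 0 < ∫ ω, l 0 ω ∂P)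
    (hx : x ∈ Set.Icc (-B) A) {τ : Ω → ℕ∞} {D : Set Ω}
    (hτ : τ = exitTime (fun n ω => x + walk l n ω) A B)
    (hD : D = decideOne (fun n ω => x + walk l n ω) A B) :
    (∀ᵐ ω ∂P, τ ω ≠ ⊤ ∧ 1 ≤ (τ ω).toNat ∧ -B - b ≤ x + walk l (τ ω).toNat ω ∧
      x + walk l (τ ω).toNat ω ≤ A + b ∧ (ω ∈ D → A ≤ x + walk l (τ ω).toNat ω) ∧
      (ω ∉ D → x + walk l (τ ω).toNat ω ≤ -B)) ∧
    Integrable (fun ω => walk l (τ ω).toNat ω) P ∧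
    ∫ ω, walk l (τ ω).toNat ω ∂P = (∫ ω, l 0 ω ∂P) * ∫ ω, ((τ ω).toNat : ℝ) ∂P ∧
    1 ≤ ∫ ω, ((τ ω).toNat : ℝ) ∂P ∧
    MeasurableSet D := by
  subst hτ hD
  set τ := exitTime (fun n ω => x + walk l n ω) A B with hτ
  set D := decideOne (fun n ω => x + walk l n ω) A B with hD
  have ht : IsTest F τ D := M.isTest_exit A B x
  have hE : expectedTime P τ ≠ ⊤ := M.expectedTime_exit_ne_top hμ hx
  have hfin := ne_top_of_expectedTime ht.measurable_time hE
  have hfacts : ∀ᵐ ω ∂P, τ ω ≠ ⊤ ∧ 1 ≤ (τ ω).toNat ∧ -B - b ≤ x + walk l (τ ω).toNat ω ∧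
      x + walk l (τ ω).toNat ω ≤ A + b ∧ (ω ∈ D → A ≤ x + walk l (τ ω).toNat ω) ∧
      (ω ∉ D → x + walk l (τ ω).toNat ω ≤ -B) := by
    filter_upwards [hfin, M.ae_bound] with ω hω hb
    obtain ⟨n, hn⟩ := ENat.ne_top_iff_exists.1 hω
    have hn' := hn.symm
    have hex := exitTime_eq_iff.1 hn'
    have hbd := abs_exit_le hx hb n
    rw [← hτ, stopAt_of_le hn' le_rfl] at hbd
    rw [hn', ENat.toNat_natCast]
    refine ⟨ENat.natCast_ne_top n, hex.1, hbd.1, hbd.2, ?_, ?_⟩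
    · rintro ⟨k, hk, hA⟩
      rw [← hτ, hn'] at hk
      have : n = k := by exact_mod_cast hk
      exact this ▸ hA
    · intro hnd
      by_contra hc
      exact hex.2.1 ⟨not_le.1 hc, not_le.1 fun hA => hnd ⟨n, hn', hA⟩⟩
  have hi := M.integrable_comp continuous_id
  have hint := expectedTime_eq_integral ht.measurable_time hE
  have hWi : Integrable (fun ω => walk l (τ ω).toNat ω) P := by
    refine Integrable.of_bound (ht.aestronglyMeasurable_stopped hfin hi) (|A| + |B| + |x| + |b|) ?_
    filter_upwards [hfacts] with ω hω
    rw [Real.norm_eq_abs, abs_le]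
    have := neg_abs_le A
    have := le_abs_self A
    have := neg_abs_le B
    have := le_abs_self B
    have := neg_abs_le x
    have := le_abs_self x
    have := le_abs_self b
    constructor <;> linarith [hω.2.2.1, hω.2.2.2.1]
  refine ⟨hfacts, hWi, ?_, ?_, measurableSet_decideOne
    (fun n => (M.measurable_walk' n).const_add x) A B⟩
  -- The stopped walk is bounded, so Wald's identity passes from truncated times to the exit time.
  · have h1 : Tendsto (fun N => ∫ ω, walk l (stopAt τ N ω) ω ∂P) atTop
        (𝓝 (∫ ω, walk l (τ ω).toNat ω ∂P)) := by
      refine ht.tendsto_integral_stopped hfin hi (c := |A| + |B| + |x| + |b|) ?_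
      filter_upwards [M.ae_bound] with ω hω N
      have hbd := abs_exit_le hx hω N
      rw [abs_le]
      have := neg_abs_le A
      have := le_abs_self A
      have := neg_abs_le B
      have := le_abs_self B
      have := neg_abs_le x
      have := le_abs_self x
      have := le_abs_self b
      constructor <;> linarith [hbd.1, hbd.2]
    have h2 := (ht.tendsto_integral_stopAt hE).const_mul (∫ ω, l 0 ω ∂P)
    simp only [← M.integral_walk_stopAt ht] at h2
    exact tendsto_nhds_unique h1 h2
  · have := integral_mono_ae (integrable_const (1 : ℝ)) hint.1
      (by filter_upwards [hfacts] with ω hω; exact_mod_cast hω.2.1)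
    simpa using this

end LLRModel

end Optimality

/-! ### Exit probabilities and the dynamic programming step. -/

section WaldWolfowitz

variable {Ω : Type*} {m : MeasurableSpace Ω} {P Q : Measure Ω} {F : Filtration ℕ m}
  {l : ℕ → Ω → ℝ} {b : ℝ}

lemma decideOne_inter_ne_top (Z : ℕ → Ω → ℝ) (A B : ℝ) :
    decideOne Z A B ∩ {ω | exitTime Z A B ω ≠ ⊤} = decideOne Z A B := by
  refine Set.inter_eq_left.2 ?_
  rintro ω ⟨n, hn, -⟩
  rw [Set.mem_ofPred_eq, hn]
  exact ENat.natCast_ne_top n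

/-- Optional stopping for a bounded process with constant cost per step. -/
lemma IsTest.integral_le_cost [IsProbabilityMeasure P] {τ : Ω → ℕ∞} {D : Set Ω} (h : IsTest F τ D)
    (hE : expectedTime P τ ≠ ⊤) {Y : ℕ → Ω → ℝ} {c κ : ℝ} (hYm : ∀ n, Measurable (Y n))
    (hYc : ∀ n ω, |Y n ω| ≤ c)
    (hle : ∀ n : ℕ, ∫ ω in {ω | (n : ℕ∞) < τ ω}, Y n ω ∂P
      ≤ ∫ ω in {ω | (n : ℕ∞) < τ ω}, (κ + Y (n + 1) ω) ∂P) :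
    ∫ ω, Y 0 ω ∂P ≤ κ * ∫ ω, ((τ ω).toNat : ℝ) ∂P + ∫ ω, Y (τ ω).toNat ω ∂P := by
  have hYi : ∀ n, Integrable (Y n) P := fun n =>
    Integrable.of_bound (hYm n).aestronglyMeasurable c (Eventually.of_forall (hYc n))
  have hXi : ∀ n : ℕ, Integrable (fun ω => κ * n + Y n ω) P := fun n =>
    (integrable_const _).add (hYi n)
  have hfin := ne_top_of_expectedTime h.measurable_time hE
  have key : ∀ N, ∫ ω, Y 0 ω ∂P
      ≤ κ * ∫ ω, (stopAt τ N ω : ℝ) ∂P + ∫ ω, Y (stopAt τ N ω) ω ∂P := by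
    intro N
    have := h.integral_le_stopped (X := fun n ω => κ * n + Y n ω) hXi (fun n => by
      have h1 : ∀ ω, κ * ((n + 1 : ℕ) : ℝ) + Y (n + 1) ω = κ * n + (κ + Y (n + 1) ω) := fun ω => by
        push_cast; ring
      simp only [h1]
      have hi2 : Integrable (fun ω => κ + Y (n + 1) ω) P := (integrable_const _).add (hYi _)
      rw [integral_add (integrable_const _).integrableOn (hYi n).integrableOn,
        integral_add (integrable_const _).integrableOn hi2.integrableOn]
      linarith [hle n]) N
    simp only [Nat.cast_zero, mul_zero, zero_add] at this
    rwa [integral_add ((h.integrable_stopAt N).const_mul κ) (h.integrable_stopped hYi N),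
      integral_const_mul] at this
  refine le_of_tendsto_of_tendsto' tendsto_const_nhds
    (((h.tendsto_integral_stopAt hE).const_mul κ).add (h.tendsto_integral_stopped hfin hYi (c := c) ?_)) key
  exact Eventually.of_forall fun ω N => hYc _ _

namespace LLRModel

variable [IsProbabilityMeasure P] [IsProbabilityMeasure Q] {A B x : ℝ}

lemma exit_density (M : LLRModel P Q F l b) {τ : Ω → ℕ∞} {D : Set Ω}
    (hτ : τ = exitTime (fun n ω => x + walk l n ω) A B)
    (hD : D = decideOne (fun n ω => x + walk l n ω) A B) :
    IntegrableOn (fun ω => Real.exp (-walk l (τ ω).toNat ω)) D P ∧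
      ∫ ω in D, Real.exp (-walk l (τ ω).toNat ω) ∂P = Q.real D := by
  have h := M.stopped_density (Q := Q) (M.isTest_exit A B x)
  rw [decideOne_inter_ne_top] at h
  subst hτ hD
  exact h

/-- Wald's inequalities: at the exit the density `exp (-walk)` is at least `exp (x + B)` on the
lower side and at most `exp (x - A)` on the upper side. -/
lemma exit_bounds (M : LLRModel P Q F l b) (hμ : 0 < ∫ ω, l 0 ω ∂P)
    (hx : x ∈ Set.Icc (-B) A) {τ : Ω → ℕ∞} {D : Set Ω}
    (hτ : τ = exitTime (fun n ω => x + walk l n ω) A B)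
    (hD : D = decideOne (fun n ω => x + walk l n ω) A B) :
    Real.exp (x + B) * P.real Dᶜ ≤ 1 - Q.real D ∧
    Q.real D ≤ Real.exp (x - A) * (1 - P.real Dᶜ) := by
  obtain ⟨hf, -, -, -, hDm⟩ := M.exit_facts hμ hx hτ hD
  obtain ⟨hi, he⟩ := M.exit_density (Q := Q) hτ hD
  have ht : IsTest F τ D := by subst hτ hD; exact M.isTest_exit A B x
  obtain ⟨hci, hce⟩ := M.stopped_density (Q := Q) ht.compl
  set E := Dᶜ ∩ {ω | τ ω ≠ ⊤}
  have hEm : MeasurableSet E := ht.compl.measurableSet_inter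
  have hEP : P.real E = P.real Dᶜ := by
    refine measureReal_congr ?_
    filter_upwards [hf] with ω hω
    exact propext ⟨fun h => h.1, fun h => ⟨h, hω.1⟩⟩
  have hEQ : Q.real E ≤ 1 - Q.real D := by
    rw [← probReal_compl_eq_one_sub hDm]
    exact measureReal_mono Set.inter_subset_left
  have hPD : 1 - P.real Dᶜ = P.real D := by
    rw [probReal_compl_eq_one_sub hDm]; ring
  constructor
  · rw [← hEP]
    refine le_trans ?_ (hce.le.trans hEQ)
    have h1 : ∫ ω in E, Real.exp (x + B) ∂P = Real.exp (x + B) * P.real E := by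
      simp [mul_comm]
    rw [← h1]
    refine setIntegral_mono_on_ae (integrable_const _).integrableOn hci hEm ?_
    filter_upwards [hf] with ω hω hE
    exact Real.exp_le_exp.2 (by linarith [hω.2.2.2.2.2 hE.1])
  · rw [hPD, ← he]
    have h1 : ∫ ω in D, Real.exp (x - A) ∂P = Real.exp (x - A) * P.real D := by
      simp [mul_comm]
    rw [← h1]
    refine setIntegral_mono_on_ae hi (integrable_const _).integrableOn hDm ?_
    filter_upwards [hf] with ω hω hE
    exact Real.exp_le_exp.2 (by linarith [hω.2.2.2.2.1 hE])

/-- Started at the upper boundary, the walk may leave downwards. -/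
lemma exit_top_lt (M : LLRModel P Q F l b) (hμ : 0 < ∫ ω, l 0 ω ∂P) (hAB : -B ≤ A)
    {τ : Ω → ℕ∞} {D : Set Ω} (hτ : τ = exitTime (fun n ω => A + walk l n ω) A B)
    (hD : D = decideOne (fun n ω => A + walk l n ω) A B) : Q.real D < 1 := by
  have hx : A ∈ Set.Icc (-B) A := ⟨hAB, le_rfl⟩
  obtain ⟨hf, hWi, hW, hN, hDm⟩ := M.exit_facts hμ hx hτ hD
  obtain ⟨hi, he⟩ := M.exit_density (Q := Q) hτ hD
  obtain ⟨hb, -⟩ := M.exit_bounds (Q := Q) hμ hx hτ hD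
  refine lt_of_le_of_ne measureReal_le_one fun h1 => ?_
  rw [h1, sub_self] at hb
  -- If `Q` always left upwards, so would `P`. Then the stopped walk is nonnegative while `exp
  -- (-walk)` has mean 1, so the stopped walk vanishes, against its positive mean from Wald's
  -- identity.
  have hp : P.real Dᶜ = 0 := le_antisymm
    (by have := Real.exp_pos (A + B); by_contra hc; nlinarith) measureReal_nonneg
  have hDae : ∀ᵐ ω ∂P, ω ∈ D := by
    rw [measureReal_eq_zero_iff] at hp
    exact mem_ae_iff.2 hp
  have hrestr : P.restrict D = P := Measure.restrict_eq_self_of_ae_mem hDae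
  rw [IntegrableOn, hrestr] at hi
  rw [hrestr, h1] at he
  have hz : ∫ ω, (1 - Real.exp (-walk l (τ ω).toNat ω)) ∂P = 0 := by
    rw [integral_sub (integrable_const 1) hi, he]; simp
  have hnn : 0 ≤ᵐ[P] fun ω => 1 - Real.exp (-walk l (τ ω).toNat ω) := by
    filter_upwards [hf, hDae] with ω hω hωD
    have : Real.exp (-walk l (τ ω).toNat ω) ≤ 1 :=
      Real.exp_le_one_iff.2 (by linarith [hω.2.2.2.2.1 hωD])
    simpa using this
  have hzero := (integral_eq_zero_iff_of_nonneg_ae hnn ((integrable_const 1).sub hi)).1 hz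
  have : ∫ ω, walk l (τ ω).toNat ω ∂P = 0 := by
    refine integral_eq_zero_of_ae ?_
    filter_upwards [hzero] with ω hω
    simp only [Pi.zero_apply, sub_eq_zero] at hω ⊢
    have := (Real.exp_eq_one_iff _).1 hω.symm
    linarith
  rw [this] at hW
  nlinarith

omit [IsProbabilityMeasure Q] in
/-- Started at the lower boundary, the walk may leave upwards. -/
lemma exit_bot_lt (M : LLRModel P Q F l b) (hμ : 0 < ∫ ω, l 0 ω ∂P) (hAB : -B ≤ A)
    {τ : Ω → ℕ∞} {D : Set Ω} (hτ : τ = exitTime (fun n ω => -B + walk l n ω) A B)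
    (hD : D = decideOne (fun n ω => -B + walk l n ω) A B) : P.real Dᶜ < 1 := by
  have hx : -B ∈ Set.Icc (-B) A := ⟨le_rfl, hAB⟩
  obtain ⟨hf, hWi, hW, hN, hDm⟩ := M.exit_facts hμ hx hτ hD
  refine lt_of_le_of_ne measureReal_le_one fun h1 => ?_
  have hDae : ∀ᵐ ω ∂P, ω ∉ D := by
    rw [probReal_compl_eq_one_sub hDm] at h1
    have : P.real D = 0 := by linarith
    rw [measureReal_eq_zero_iff] at this
    exact measure_eq_zero_iff_ae_notMem.1 this
  -- Leaving downwards almost surely makes the stopped walk nonpositive, against its positive mean.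
  have : ∫ ω, walk l (τ ω).toNat ω ∂P ≤ 0 := by
    refine integral_nonpos_of_ae ?_
    filter_upwards [hf, hDae] with ω hω hωD
    have := hω.2.2.2.2.2 hωD
    simp only [Pi.zero_apply]
    linarith
  nlinarith

variable {V : ℝ → ℝ} {w₀ w₁ : ℝ}

omit [IsProbabilityMeasure Q] in
/-- One step of the dynamic programming recursion along the walk started at `x`. -/
lemma bellman_step (M : LLRModel P Q F l b) (hV : Measurable V) (h0 : ∀ u, 0 ≤ V u)
    (h1 : ∀ u, V u ≤ w₁) (x : ℝ) (n : ℕ) {G : Set Ω} (hG : MeasurableSet[F n] G) :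
    ∫ ω in G, (1 + V (Real.exp (-(x + walk l (n + 1) ω)))) ∂P
      = ∫ ω in G, (1 + ∫ s, V (Real.exp (-(x + walk l n ω)) * Real.exp (-s)) ∂(P.map (l 0))) ∂P := by
  have := M.isProbabilityMeasure_law
  have hmV : ∀ y : Ω → ℝ, Measurable y → Integrable (fun ω => V (Real.exp (-y ω))) P :=
    fun y hy => Integrable.of_bound (hV.comp (by fun_prop)).aestronglyMeasurable w₁
      (Eventually.of_forall fun ω => by rw [Real.norm_eq_abs, abs_of_nonneg (h0 _)]; exact h1 _)
  have key := M.setIntegral_step n hG (M.measurable_walk n)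
    (h := fun w s => 1 + V (Real.exp (-(x + (w + s)))))
    (measurable_const.add (hV.comp (by fun_prop)))
    ((integrable_const 1).add (hmV (fun ω => x + (walk l n ω + l n ω))
      (((M.measurable_walk' n).add (M.measurable_inc n)).const_add x)))
  simp only [← walk_succ] at key
  rw [key]
  congr 1
  funext ω
  have hs : ∀ s, Real.exp (-(x + (walk l n ω + s)))
      = Real.exp (-(x + walk l n ω)) * Real.exp (-s) := fun s => by
    rw [← Real.exp_add]; congr 1; ring
  simp only [hs]
  rw [integral_add (integrable_const 1) (integrable_comp_of_bdd hV h0 h1 _)]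
  simp

omit [IsProbabilityMeasure Q] in
lemma integrable_value_stopped (M : LLRModel P Q F l b)
    (hV : Measurable V) (h0 : ∀ u, 0 ≤ V u)
    (h1 : ∀ u, V u ≤ w₁) (x : ℝ) {τ : Ω → ℕ∞} (hτ : Measurable τ) :
    Integrable (fun ω => V (Real.exp (-(x + walk l (τ ω).toNat ω)))) P := by
  have hn : Measurable fun ω => (τ ω).toNat :=
    (measurable_from_top : Measurable fun x : ℕ∞ => x.toNat).comp hτ
  have hw : Measurable fun ω => walk l (τ ω).toNat ω :=
    (measurable_from_prod_countable_right (f := fun p : ℕ × Ω => walk l p.1 p.2)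
      fun n => M.measurable_walk' n).comp (hn.prodMk measurable_id)
  refine Integrable.of_bound (hV.comp (by fun_prop)).aestronglyMeasurable w₁
    (Eventually.of_forall fun ω => ?_)
  rw [Real.norm_eq_abs, abs_of_nonneg (h0 _)]
  exact h1 _

end LLRModel

end WaldWolfowitz

/-! ### The value function compared with the cost of stopping rules. -/

section WaldWolfowitz

variable {Ω : Type*} {m : MeasurableSpace Ω} {P Q : Measure Ω} {F : Filtration ℕ m}
  {l : ℕ → Ω → ℝ} {b : ℝ}

namespace LLRModel

variable [IsProbabilityMeasure P] {A B x : ℝ} {V : ℝ → ℝ} {w₀ w₁ : ℝ}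

/-- The value function is a lower bound for the cost of every test. -/
lemma value_le (M : LLRModel P Q F l b) (hV : Measurable V) (h0 : ∀ u, 0 ≤ V u)
    (h1 : ∀ u, V u ≤ w₁)
    (hB : ∀ u, 0 ≤ u → V u ≤ 1 + ∫ s, V (u * Real.exp (-s)) ∂(P.map (l 0)))
    {τ : Ω → ℕ∞} {D : Set Ω} (h : IsTest F τ D) (hE : expectedTime P τ ≠ ⊤) :
    V 1 ≤ ∫ ω, ((τ ω).toNat : ℝ) ∂P + ∫ ω, V (Real.exp (-(walk l (τ ω).toNat ω))) ∂P := by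
  have := M.isProbabilityMeasure_law
  have hm : ∀ n, Measurable fun ω => V (Real.exp (-(0 + walk l n ω))) := fun n =>
    hV.comp (((M.measurable_walk' n).const_add 0).neg.exp)
  have hbd : ∀ n ω, |V (Real.exp (-(0 + walk l n ω)))| ≤ w₁ := fun n ω => by
    rw [abs_of_nonneg (h0 _)]; exact h1 _
  have hqm := measurable_continuation (ρ := P.map (l 0)) hV
  have key := h.integral_le_cost hE (Y := fun n ω => V (Real.exp (-(0 + walk l n ω)))) (κ := 1)
    hm hbd fun n => by
      rw [M.bellman_step hV h0 h1 0 n (h.lt n)]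
      refine integral_mono (Integrable.of_bound (hm n).aestronglyMeasurable w₁
        (Eventually.of_forall (hbd n))) ?_ fun ω => hB _ (Real.exp_pos _).le
      refine Integrable.of_bound ((measurable_const.add (hqm.comp
        (((M.measurable_walk' n).const_add 0).neg.exp))).aestronglyMeasurable) (1 + w₁)
        (Eventually.of_forall fun ω => ?_)
      have hle : ∀ u, ∫ s, V (u * Real.exp (-s)) ∂(P.map (l 0)) ≤ w₁ := fun u => by
        have := integral_mono (integrable_comp_of_bdd (ρ := P.map (l 0)) hV h0 h1 u)
          (integrable_const w₁) fun s => h1 _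
        simpa using this
      rw [Real.norm_eq_abs, abs_of_nonneg
        (add_nonneg zero_le_one (integral_nonneg fun s => h0 _))]
      linarith [hle (Real.exp (-(0 + walk l n ω)))]
  simpa using key

/-- The cost of continuing from `x` is at most that of continuing up to the exit from `(-B, A)`,
with equality if the Bellman equation holds with continuation inside the interval. -/
lemma continue_le_exit (M : LLRModel P Q F l b) (hμ : 0 < ∫ ω, l 0 ω ∂P)
    (hx : x ∈ Set.Icc (-B) A) (hV : Measurable V) (h0 : ∀ u, 0 ≤ V u)
    (h1 : ∀ u, V u ≤ w₁)
    (hB : ∀ u, 0 ≤ u → V u ≤ 1 + ∫ s, V (u * Real.exp (-s)) ∂(P.map (l 0)))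
    {τ : Ω → ℕ∞} (hτ : τ = exitTime (fun n ω => x + walk l n ω) A B) :
    1 + ∫ s, V (Real.exp (-x) * Real.exp (-s)) ∂(P.map (l 0))
        ≤ ∫ ω, ((τ ω).toNat : ℝ) ∂P + ∫ ω, V (Real.exp (-(x + walk l (τ ω).toNat ω))) ∂P ∧
      ((∀ y ∈ Set.Ioo (-B) A, V (Real.exp (-y))
          = 1 + ∫ s, V (Real.exp (-y) * Real.exp (-s)) ∂(P.map (l 0))) →
        ∫ ω, ((τ ω).toNat : ℝ) ∂P + ∫ ω, V (Real.exp (-(x + walk l (τ ω).toNat ω))) ∂P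
          ≤ 1 + ∫ s, V (Real.exp (-x) * Real.exp (-s)) ∂(P.map (l 0))) := by
  have := M.isProbabilityMeasure_law
  have hf := (M.exit_facts hμ hx hτ rfl).1
  have ht : IsTest F τ (decideOne (fun n ω => x + walk l n ω) A B) := by
    subst hτ; exact M.isTest_exit A B x
  have hE : expectedTime P τ ≠ ⊤ := by subst hτ; exact M.expectedTime_exit_ne_top hμ hx
  set q : ℝ → ℝ := fun u => 1 + ∫ s, V (u * Real.exp (-s)) ∂(P.map (l 0)) with hq
  have hqm : Measurable q := measurable_const.add (measurable_continuation hV)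
  have hq0 : ∀ u, 0 ≤ q u := fun u => add_nonneg zero_le_one (integral_nonneg fun s => h0 _)
  have hq1 : ∀ u, q u ≤ 1 + w₁ := fun u => by
    have := integral_mono (integrable_comp_of_bdd (ρ := P.map (l 0)) hV h0 h1 u)
      (integrable_const w₁) fun s => h1 _
    simp only [integral_const, probReal_univ, one_smul] at this
    simp only [hq]; linarith
  -- The first step is compulsory, so the initial value is the cost of continuing rather than `V`;
  -- this matters when `x` is an endpoint.
  let Y : ℕ → Ω → ℝ := fun n ω => if n = 0 then q (Real.exp (-x))
    else V (Real.exp (-(x + walk l n ω)))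
  have hYm : ∀ n, Measurable (Y n) := by
    intro n
    by_cases hn : n = 0
    · simp only [Y, hn, if_true]; exact measurable_const
    · simp only [Y, hn, if_false]
      exact hV.comp (((M.measurable_walk' n).const_add x).neg.exp)
  have hYc : ∀ n ω, |Y n ω| ≤ 1 + w₁ := by
    intro n ω
    by_cases hn : n = 0
    · simp only [Y, hn, if_true]; rw [abs_of_nonneg (hq0 _)]; exact hq1 _
    · simp only [Y, hn, if_false]; rw [abs_of_nonneg (h0 _)]; linarith [h1 (Real.exp (-(x + walk l n ω)))]
  have hstep : ∀ n : ℕ, ∫ ω in {ω | (n : ℕ∞) < τ ω}, (1 + Y (n + 1) ω) ∂P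
      = ∫ ω in {ω | (n : ℕ∞) < τ ω}, q (Real.exp (-(x + walk l n ω))) ∂P := fun n =>
    M.bellman_step hV h0 h1 x n (ht.lt n)
  have hqi : ∀ n, Integrable (fun ω => q (Real.exp (-(x + walk l n ω)))) P := fun n =>
    Integrable.of_bound (hqm.comp (((M.measurable_walk' n).const_add x).neg.exp)
      ).aestronglyMeasurable (1 + w₁) (Eventually.of_forall fun ω => by
        rw [Real.norm_eq_abs, abs_of_nonneg (hq0 _)]; exact hq1 _)
  have hYi : ∀ n, Integrable (Y n) P := fun n =>
    Integrable.of_bound (hYm n).aestronglyMeasurable _ (Eventually.of_forall (hYc n))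
  have hY0 : ∀ ω, Y 0 ω = q (Real.exp (-x)) := fun ω => by simp [Y]
  have hYτ : ∫ ω, Y (τ ω).toNat ω ∂P
      = ∫ ω, V (Real.exp (-(x + walk l (τ ω).toNat ω))) ∂P := by
    refine integral_congr_ae ?_
    filter_upwards [hf] with ω hω
    have : (τ ω).toNat ≠ 0 := by have := hω.2.1; omega
    simp only [Y, this, if_false]
  constructor
  · have key := ht.integral_le_cost hE (κ := 1) hYm hYc fun n => by
      rw [hstep n]
      refine integral_mono (hYi n).integrableOn (hqi n).integrableOn fun ω => ?_
      by_cases hn : n = 0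
      · subst hn; simp [Y]
      · simp only [Y, hn, if_false]; exact hB _ (Real.exp_pos _).le
    simp only [hY0, integral_const, probReal_univ, one_smul, one_mul, hYτ] at key
    exact key
  · intro hcont
    have key := ht.integral_le_cost hE (Y := fun n ω => -Y n ω) (κ := -1)
      (fun n => (hYm n).neg) (fun n ω => by rw [abs_neg]; exact hYc n ω) fun n => by
      have h2 : ∀ ω, -1 + -Y (n + 1) ω = -(1 + Y (n + 1) ω) := fun ω => by ring
      simp only [h2, integral_neg]
      rw [hstep n]
      refine neg_le_neg (le_of_eq (setIntegral_congr_fun (F.le n _ (ht.lt n)) fun ω hω => ?_))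
      by_cases hn : n = 0
      · subst hn; simp [Y]
      · simp only [Y, hn, if_false]
        have hω' : (n : ℕ∞) < exitTime (fun n ω => x + walk l n ω) A B ω := by rw [← hτ]; exact hω
        exact (hcont _ (mem_Ioo_of_lt_exitTime hω' (Nat.pos_of_ne_zero hn))).symm
    simp only [hY0, integral_neg, integral_const, probReal_univ, one_smul, hYτ] at key
    simp only [hq] at key
    linarith

end LLRModel

end WaldWolfowitz

/-! ### Choice of the weights and optimality of the SPRT. -/

section WaldWolfowitz

variable {Ω : Type*} {m : MeasurableSpace Ω} {P Q : Measure Ω} {F : Filtration ℕ m}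
  {l : ℕ → Ω → ℝ} {b : ℝ}

/-- The linear system that makes stopping and continuing equally good at both boundaries. -/
lemma exists_weights {X Y p z E N₁ N₂ : ℝ} (hE : 1 < E) (hX : 0 < X) (hY : 0 < Y)
    (hp : 0 ≤ p) (hz : 0 ≤ z) (hpX : E * p ≤ X) (hzY : z ≤ Y) (hN₁ : 0 ≤ N₁) (hN₂ : 0 ≤ N₂) :
    ∃ v w : ℝ, 0 ≤ v ∧ 0 ≤ w ∧ v * X = w * p + N₁ ∧ w * Y = v * z + N₂ := by
  -- `E > 1` gives `p < X`, so the determinant is positive and Cramer's rule yields nonnegative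
  -- solutions.
  have hdet : 0 < X * Y - p * z := by
    have h1 : p < X := by
      rcases hp.eq_or_lt with rfl | hp'
      · exact hX
      · nlinarith
    have h2 : p * z ≤ p * Y := mul_le_mul_of_nonneg_left hzY hp
    have h3 : p * Y < X * Y := mul_lt_mul_of_pos_right h1 hY
    linarith
  refine ⟨(N₁ * Y + p * N₂) / (X * Y - p * z), (N₂ * X + z * N₁) / (X * Y - p * z),
    by positivity, by positivity, ?_, ?_⟩
  · rw [div_mul_eq_mul_div, div_mul_eq_mul_div, div_add' _ _ _ hdet.ne', div_left_inj' hdet.ne']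
    ring
  · rw [div_mul_eq_mul_div, div_mul_eq_mul_div, div_add' _ _ _ hdet.ne', div_left_inj' hdet.ne']
    ring

namespace LLRModel

variable [IsProbabilityMeasure P] [IsProbabilityMeasure Q] {A B x : ℝ} {V : ℝ → ℝ} {w₀ w₁ : ℝ}

/-- The terminal cost of a test, in terms of its error probabilities. -/
lemma terminal_le (M : LLRModel P Q F l b) (hV : Measurable V) (h0 : ∀ u, 0 ≤ V u)
    (h1 : ∀ u, V u ≤ w₁) (h2 : ∀ u, 0 ≤ u → V u ≤ w₀ * u) (x : ℝ)
    {τ : Ω → ℕ∞} {D : Set Ω} (h : IsTest F τ D) :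
    ∫ ω, V (Real.exp (-(x + walk l (τ ω).toNat ω))) ∂P
      ≤ w₀ * Real.exp (-x) * Q.real (D ∩ {ω | τ ω ≠ ⊤})
        + w₁ * P.real (D ∩ {ω | τ ω ≠ ⊤})ᶜ := by
  obtain ⟨hi, he⟩ := M.stopped_density (Q := Q) h
  have hm := h.measurableSet_inter
  have hVi := M.integrable_value_stopped (P := P) hV h0 h1 x h.measurable_time
  rw [← integral_add_compl hm hVi, ← he, ← integral_const_mul]
  refine add_le_add ?_ ?_
  · refine integral_mono hVi.integrableOn (hi.const_mul _) fun ω => ?_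
    refine (h2 _ (Real.exp_pos _).le).trans (le_of_eq ?_)
    rw [neg_add, Real.exp_add, mul_assoc]
  -- Never stopping counts as an error here: on `{τ = ⊤}` the integrand has the default index 0 and
  -- is bounded by `w₁` all the same.
  · have := integral_mono (μ := P.restrict (D ∩ {ω | τ ω ≠ ⊤})ᶜ) hVi.integrableOn
      (integrable_const w₁) fun ω => h1 _
    refine this.trans (le_of_eq ?_)
    simp [mul_comm]

/-- **Wald–Wolfowitz theorem**: among all tests whose error probabilities do not exceed those of
the sequential probability ratio test, the latter has the smallest expected sample size. -/
theorem wald_wolfowitz (M : LLRModel P Q F l b) (hμ : 0 < ∫ ω, l 0 ω ∂P) (hA : 0 < A)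
    (hB : 0 < B) {τ : Ω → ℕ∞} {D : Set Ω} (h : IsTest F τ D) (hE : expectedTime P τ ≠ ⊤)
    (hα : Q.real (D ∩ {ω | τ ω ≠ ⊤}) ≤ Q.real (decideOne (walk l) A B))
    (hβ : P.real (D ∩ {ω | τ ω ≠ ⊤})ᶜ ≤ P.real (decideOne (walk l) A B)ᶜ) :
    ∫ ω, ((exitTime (walk l) A B ω).toNat : ℝ) ∂P ≤ ∫ ω, ((τ ω).toNat : ℝ) ∂P := by
  have := M.isProbabilityMeasure_law
  have hAB : -B ≤ A := by linarith
  obtain ⟨S, hS⟩ : ∃ S : ℝ → Ω → ℕ∞, ∀ x, S x = exitTime (fun n ω => x + walk l n ω) A B :=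
    ⟨_, fun _ => rfl⟩
  obtain ⟨U, hU⟩ : ∃ U : ℝ → Set Ω, ∀ x, U x = decideOne (fun n ω => x + walk l n ω) A B :=
    ⟨_, fun _ => rfl⟩
  have hS0 : exitTime (walk l) A B = S 0 := by rw [hS]; simp only [zero_add]
  have hU0 : decideOne (walk l) A B = U 0 := by rw [hU]; simp only [zero_add]
  rw [hS0]
  rw [hU0] at hα hβ
  let N : ℝ → ℝ := fun x => ∫ ω, ((S x ω).toNat : ℝ) ∂P
  have hN : ∀ x, 0 ≤ N x := fun x => integral_nonneg fun ω => by positivity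
  have htest : ∀ x, IsTest F (S x) (U x) := fun x => by
    rw [hS, hU]; exact M.isTest_exit A B x
  have hUfin : ∀ x, U x ∩ {ω | S x ω ≠ ⊤} = U x := fun x => by
    rw [hS, hU]; exact decideOne_inter_ne_top _ _ _
  set E := Real.exp (A + B) with hEdef
  have hE1 : 1 < E := Real.one_lt_exp_iff.2 (by linarith)
  have hxA : A ∈ Set.Icc (-B) A := ⟨hAB, le_rfl⟩
  have hxB : -B ∈ Set.Icc (-B) A := ⟨le_rfl, hAB⟩
  have hqA := M.exit_top_lt (Q := Q) hμ hAB (hS A) (hU A)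
  have hpB := M.exit_bot_lt (Q := Q) hμ hAB (hS (-B)) (hU (-B))
  have hbA := (M.exit_bounds (Q := Q) hμ hxA (hS A) (hU A)).1
  have hbB := (M.exit_bounds (Q := Q) hμ hxB (hS (-B)) (hU (-B))).2
  have hzB : E * Q.real (U (-B)) ≤ 1 - P.real (U (-B))ᶜ := by
    have h3 : E * Real.exp (-B - A) = 1 := by
      rw [hEdef, ← Real.exp_add, ← Real.exp_zero]; congr 1; ring
    calc E * Q.real (U (-B)) ≤ E * (Real.exp (-B - A) * (1 - P.real (U (-B))ᶜ)) := by gcongr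
      _ = 1 - P.real (U (-B))ᶜ := by rw [← mul_assoc, h3, one_mul]
  -- Stopping costs `v = w₀ exp (-A)` at the upper boundary and `w₁` at the lower one. Each is
  -- equated with the cost of continuing from there to the next exit and then stopping.
  obtain ⟨v, w₁, hv, hw₁, hvA, hwB⟩ := exists_weights (N₁ := N A) (N₂ := N (-B)) hE1
    (sub_pos.2 hqA) (sub_pos.2 hpB) (p := P.real (U A)ᶜ) measureReal_nonneg
    (mul_nonneg (zero_le_one.trans hE1.le) measureReal_nonneg) hbA hzB (hN _) (hN _)
  obtain ⟨w₀, hw₀, hv0⟩ : ∃ w₀, 0 ≤ w₀ ∧ v = w₀ * Real.exp (-A) :=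
    ⟨v * Real.exp A, by positivity, by rw [mul_assoc, ← Real.exp_add]; simp⟩
  obtain ⟨V, hVm, hV0, hV1, hVmono, hVstar, hVeq⟩ :=
    exists_valueFunction (P.map (l 0)) hw₀ hw₁
  have hVle : ∀ u, 0 ≤ u → V u ≤ w₀ * u := fun u hu => by
    rw [hVeq u hu]; exact (min_le_left _ _).trans (min_le_left _ _)
  have hVB : ∀ u, 0 ≤ u → V u ≤ 1 + ∫ s, V (u * Real.exp (-s)) ∂(P.map (l 0)) := fun u hu => by
    conv_lhs => rw [hVeq u hu]
    exact min_le_right _ _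
  have hVi := integrable_comp_of_bdd (ρ := P.map (l 0)) hVm hV0 hV1
  set q : ℝ → ℝ := fun u => 1 + ∫ s, V (u * Real.exp (-s)) ∂(P.map (l 0)) with hq
  have hqmono : Monotone q := fun u u' huu => by
    refine add_le_add_right (integral_mono (hVi u) (hVi u') fun s => hVmono ?_) 1
    gcongr
  have hqstar : ∀ u u', 0 ≤ u → u ≤ u' → q u' * u ≤ q u * u' := by
    intro u u' hu huu
    simp only [hq, add_mul]
    rw [← integral_mul_const, ← integral_mul_const]
    refine add_le_add (by linarith) (integral_mono ((hVi u').mul_const u) ((hVi u).mul_const u')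
      fun s => ?_)
    have hs := Real.exp_pos (-s)
    have := hVstar (u * Real.exp (-s)) (u' * Real.exp (-s)) (by positivity) (by gcongr)
    dsimp only
    nlinarith
  -- continuing at a boundary costs at most as much as stopping there
  have hcont : ∀ x ∈ Set.Icc (-B) A, q (Real.exp (-x))
      ≤ N x + (w₀ * Real.exp (-x) * Q.real (U x) + w₁ * P.real (U x)ᶜ) := fun x hx => by
    have h3 := (M.continue_le_exit hμ hx hVm hV0 hV1 hVB (hS x)).1
    have h4 := M.terminal_le (Q := Q) hVm hV0 hV1 hVle x (htest x)
    rw [hUfin] at h4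
    exact h3.trans (by simp only [N]; linarith)
  have hqA' : q (Real.exp (-A)) ≤ w₀ * Real.exp (-A) := by
    have := hcont A hxA
    rw [← hv0] at this ⊢
    linarith
  have hEB : v * E = w₀ * Real.exp B := by
    rw [hv0, hEdef, mul_assoc, ← Real.exp_add]; congr 2; ring
  have hqB' : q (Real.exp B) ≤ w₁ := by
    have := hcont (-B) hxB
    rw [neg_neg, ← hEB] at this
    linarith
  -- Antitonicity of `q u / u` carries `q u ≤ w₀ u` inwards from `A`; monotonicity of `q` carries `q
  -- u ≤ w₁` inwards from `-B`.
  have hVq : ∀ y ∈ Set.Icc (-B) A, V (Real.exp (-y)) = q (Real.exp (-y)) := by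
    intro y hy
    rw [hVeq _ (Real.exp_pos _).le]
    refine min_eq_right (le_min ?_ ?_)
    · have h3 := hqstar (Real.exp (-A)) (Real.exp (-y)) (Real.exp_pos _).le
        (Real.exp_le_exp.2 (by linarith [hy.2]))
      have h4 : q (Real.exp (-A)) * Real.exp (-y) ≤ w₀ * Real.exp (-A) * Real.exp (-y) := by gcongr
      have := Real.exp_pos (-A)
      refine le_of_mul_le_mul_right (h3.trans (h4.trans (le_of_eq ?_))) this
      ring
    · exact (hqmono (Real.exp_le_exp.2 (by linarith [hy.1]))).trans hqB'
  -- the gains of continuing at the two boundaries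
  set dA := w₀ * Real.exp (-A) - V (Real.exp (-A)) with hdA
  set dB := w₁ - V (Real.exp B) with hdB
  have hdA0 : 0 ≤ dA := sub_nonneg.2 (hVle _ (Real.exp_pos _).le)
  have hdB0 : 0 ≤ dB := sub_nonneg.2 (hV1 _)
  -- Inside the interval continuing is optimal, so `V` is the cost up to the exit plus the value
  -- there. Above `A` sublinearity, below `-B` monotonicity bounds that value from below by the
  -- terminal cost less the gain at the boundary.
  have hlow : ∀ x ∈ Set.Icc (-B) A, N x + ((w₀ - dA * Real.exp A) * Real.exp (-x) * Q.real (U x)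
      + (w₁ - dB) * P.real (U x)ᶜ) ≤ V (Real.exp (-x)) := by
    intro x hx
    have h3 := (M.continue_le_exit hμ hx hVm hV0 hV1 hVB (hS x)).2
      fun y hy => hVq y (Set.Ioo_subset_Icc_self hy)
    obtain ⟨hf, -, -, -, hDm⟩ := M.exit_facts hμ hx (hS x) (hU x)
    obtain ⟨hi, he⟩ := M.exit_density (Q := Q) (hS x) (hU x)
    have hVxi := M.integrable_value_stopped (P := P) hVm hV0 hV1 x (htest x).measurable_time
    rw [hVq x hx]
    refine le_trans (add_le_add_right ?_ _) h3
    rw [← integral_add_compl hDm hVxi, ← he, ← integral_const_mul]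
    refine add_le_add ?_ ?_
    · refine setIntegral_mono_on_ae (hi.const_mul _) hVxi.integrableOn hDm ?_
      filter_upwards [hf] with ω hω hωD
      have hWA := hω.2.2.2.2.1 hωD
      have h4 := hVstar (Real.exp (-(x + walk l (S x ω).toNat ω))) (Real.exp (-A))
        (Real.exp_pos _).le (Real.exp_le_exp.2 (by linarith))
      have h5 : V (Real.exp (-A)) = w₀ * Real.exp (-A) - dA := by rw [hdA]; ring
      have h6 : Real.exp A * Real.exp (-A) = 1 := by rw [← Real.exp_add]; simp
      rw [h5] at h4
      refine le_of_mul_le_mul_right (le_trans (le_of_eq ?_) h4) (Real.exp_pos (-A))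
      rw [neg_add, Real.exp_add]
      linear_combination (-dA * Real.exp (-x) * Real.exp (-walk l (S x ω).toNat ω)) * h6
    · have h4 : ∫ ω in (U x)ᶜ, (w₁ - dB) ∂P = (w₁ - dB) * P.real (U x)ᶜ := by simp [mul_comm]
      rw [← h4]
      refine setIntegral_mono_on_ae (integrable_const _).integrableOn hVxi.integrableOn
        hDm.compl ?_
      filter_upwards [hf] with ω hω hωD
      have hWB := hω.2.2.2.2.2 hωD
      have h5 : w₁ - dB = V (Real.exp B) := by rw [hdB]; ring
      rw [h5]
      exact hVmono (Real.exp_le_exp.2 (by linarith))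
  -- At `x = A` the estimate yields `dA * E ≤ dB`, at `x = -B` it yields `dB ≤ dA`; since `E > 1`,
  -- both gains vanish.
  have hzero : dA = 0 ∧ dB = 0 := by
    have h6 : Real.exp A * Real.exp (-A) = 1 := by rw [← Real.exp_add]; simp
    have h3 : dA * (1 - Q.real (U A)) ≤ dB * P.real (U A)ᶜ := by
      have h4 := hlow A hxA
      have h5 : V (Real.exp (-A)) = v - dA := by rw [hdA, hv0]; ring
      have h7 : (w₀ - dA * Real.exp A) * Real.exp (-A) = v - dA := by
        rw [hv0]; linear_combination (-dA) * h6
      rw [h5, h7] at h4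
      linarith
    have h8 : dB * (1 - P.real (U (-B))ᶜ) ≤ dA * (E * Q.real (U (-B))) := by
      have h4 := hlow (-B) hxB
      have h5 : V (Real.exp B) = w₁ - dB := by rw [hdB]; ring
      have h7 : (w₀ - dA * Real.exp A) * Real.exp B = v * E - dA * E := by
        rw [hEB, hEdef, Real.exp_add]; ring
      rw [neg_neg, h5, h7] at h4
      linarith
    have h9 : dB ≤ dA := by
      refine le_of_mul_le_mul_right (h8.trans ?_) (sub_pos.2 hpB)
      exact mul_le_mul_of_nonneg_left hzB hdA0
    have h10 : dA * E ≤ dB := by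
      refine le_of_mul_le_mul_right (a := 1 - Q.real (U A)) ?_ (sub_pos.2 hqA)
      calc dA * E * (1 - Q.real (U A)) = E * (dA * (1 - Q.real (U A))) := by ring
        _ ≤ E * (dB * P.real (U A)ᶜ) := by gcongr
        _ = dB * (E * P.real (U A)ᶜ) := by ring
        _ ≤ dB * (1 - Q.real (U A)) := by gcongr
    have h11 : dA = 0 := by nlinarith
    exact ⟨h11, le_antisymm (h9.trans h11.le) hdB0⟩
  -- With zero gains the SPRT costs at most `V 1`, which is at most the cost of any test; the error
  -- terms then cancel by hypothesis.
  have hfinal := hlow 0 ⟨by linarith, hA.le⟩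
  rw [hzero.1, hzero.2] at hfinal
  simp only [neg_zero, Real.exp_zero, zero_mul, sub_zero, mul_one] at hfinal
  have h3 := M.value_le hVm hV0 hV1 hVB h hE
  have h4 := M.terminal_le (Q := Q) hVm hV0 hV1 hVle 0 h
  simp only [neg_zero, Real.exp_zero, zero_add, mul_one] at h4
  have h5 : w₀ * Q.real (D ∩ {ω | τ ω ≠ ⊤}) ≤ w₀ * Q.real (U 0) := by gcongr
  have h6 : w₁ * P.real (D ∩ {ω | τ ω ≠ ⊤})ᶜ ≤ w₁ * P.real (U 0)ᶜ := by gcongr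
  change N 0 ≤ _
  linarith

end LLRModel

end WaldWolfowitz

/-! ### Bounds on expected sample sizes and thresholds. -/

section Bounds

variable {Ω : Type*} {m : MeasurableSpace Ω} {P Q : Measure Ω} {F : Filtration ℕ m}
  {l : ℕ → Ω → ℝ} {b : ℝ}

namespace LLRModel

variable [IsProbabilityMeasure P] [IsProbabilityMeasure Q] {A B : ℝ}

/-- Lower bound for the expected sample size of the sequential probability ratio test in terms of
its error probabilities. -/
lemma sprt_lower_bound (M : LLRModel P Q F l b) (hμ : 0 < ∫ ω, l 0 ω ∂P) (hA : 0 < A)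
    (hB : 0 < B) {α β : ℝ} (hα0 : 0 < α) (hβ0 : 0 < β)
    (hα : Q.real (decideOne (walk l) A B) = α) (hβ : P.real (decideOne (walk l) A B)ᶜ = β) :
    -Real.log α - β * (1 - Real.log α - Real.log β)
      ≤ (∫ ω, l 0 ω ∂P) * ∫ ω, ((exitTime (walk l) A B ω).toNat : ℝ) ∂P := by
  obtain ⟨τ, hτ⟩ : ∃ τ, τ = exitTime (walk l) A B := ⟨_, rfl⟩
  obtain ⟨D, hD⟩ : ∃ D, D = decideOne (walk l) A B := ⟨_, rfl⟩
  rw [← hτ]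
  rw [← hD] at hα hβ
  have hτ0 : τ = exitTime (fun n ω => 0 + walk l n ω) A B := by simp only [zero_add]; exact hτ
  have hD0 : D = decideOne (fun n ω => 0 + walk l n ω) A B := by simp only [zero_add]; exact hD
  have hx : (0 : ℝ) ∈ Set.Icc (-B) A := ⟨by linarith, hA.le⟩
  obtain ⟨hf, hWi, hW, -, hDm⟩ := M.exit_facts hμ hx hτ0 hD0
  obtain ⟨hi, he⟩ := M.exit_density (Q := Q) hτ0 hD0
  have ht : IsTest F τ D := by rw [hτ0, hD0]; exact M.isTest_exit A B 0
  obtain ⟨hci, hce⟩ := M.stopped_density (Q := Q) ht.compl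
  set E := Dᶜ ∩ {ω | τ ω ≠ ⊤}
  have hEae : E =ᵐ[P] (Dᶜ : Set Ω) := by
    filter_upwards [hf] with ω hω
    exact propext ⟨fun h => h.1, fun h => ⟨h, hω.1⟩⟩
  rw [setIntegral_congr_set hEae] at hce
  rw [integrableOn_congr_set_ae hEae] at hci
  have hQE : Q.real E ≤ 1 := measureReal_le_one
  have hPD : P.real D = 1 - β := by
    have := probReal_compl_eq_one_sub (μ := P) hDm; linarith
  -- Tangent bound with equality at `c = exp x`. It is used with `c = 1 / α` on acceptance and `c =
  -- β` on rejection, the typical sizes of `exp walk`.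
  have hpt : ∀ c x : ℝ, 0 < c → 1 + Real.log c - c * Real.exp (-x) ≤ x := by
    intro c x hc
    have h1 := Real.add_one_le_exp (Real.log c - x)
    rw [sub_eq_add_neg, Real.exp_add, Real.exp_log hc] at h1
    linarith
  rw [← hW, ← integral_add_compl hDm hWi]
  have h1 : ∫ ω in D, (1 + Real.log (1 / α) - 1 / α * Real.exp (-walk l (τ ω).toNat ω)) ∂P
      ≤ ∫ ω in D, walk l (τ ω).toNat ω ∂P :=
    integral_mono ((integrable_const _).sub (hi.const_mul _)) hWi.integrableOn
      fun ω => hpt _ _ (by positivity)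
  have h2 : ∫ ω in Dᶜ, (1 + Real.log β - β * Real.exp (-walk l (τ ω).toNat ω)) ∂P
      ≤ ∫ ω in Dᶜ, walk l (τ ω).toNat ω ∂P :=
    integral_mono ((integrable_const _).sub (hci.const_mul _)) hWi.integrableOn
      fun ω => hpt _ _ hβ0
  rw [integral_sub (integrable_const _) (hi.const_mul _), integral_const_mul, he, hα] at h1
  rw [integral_sub (integrable_const _) (hci.const_mul _), integral_const_mul, hce] at h2
  simp only [integral_const, measureReal_restrict_apply_univ, smul_eq_mul, hPD, hβ] at h1 h2
  rw [one_div, Real.log_inv, inv_mul_cancel₀ hα0.ne'] at h1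
  nlinarith

omit [IsProbabilityMeasure Q] in
/-- Exponential moments of the increments. -/
lemma integral_exp_le (M : LLRModel P Q F l b) {ε : ℝ} (hε : 0 ≤ ε) (hεb : ε * b ≤ 1) :
    ∫ ω, Real.exp (-(ε * l 0 ω)) ∂P ≤ Real.exp (-(ε * ∫ ω, l 0 ω ∂P) + ε ^ 2 * b ^ 2) := by
  have hl : Integrable (fun ω => l 0 ω) P := M.integrable_comp_inc continuous_id 0
  have he : Integrable (fun ω => Real.exp (-(ε * l 0 ω))) P :=
    M.integrable_comp_inc (h := fun x => Real.exp (-(ε * x))) (by fun_prop) 0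
  have hi : Integrable (fun ω => 1 + ε ^ 2 * b ^ 2 - ε * l 0 ω) P :=
    (integrable_const _).sub (hl.const_mul ε)
  have h1 : ∫ ω, Real.exp (-(ε * l 0 ω)) ∂P ≤ ∫ ω, (1 + ε ^ 2 * b ^ 2 - ε * l 0 ω) ∂P := by
    refine integral_mono_ae he hi ?_
    filter_upwards [M.bound 0] with ω hω
    have h2 : |-(ε * l 0 ω)| ≤ ε * b := by
      rw [abs_neg, abs_mul, abs_of_nonneg hε]; gcongr
    -- This is `exp t ≤ 1 + t + t ^ 2` for `|t| ≤ 1`.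
    have h3 := (abs_le.1 (Real.abs_exp_sub_one_sub_id_le (h2.trans hεb))).2
    have h4 : (-(ε * l 0 ω)) ^ 2 ≤ (ε * b) ^ 2 := sq_le_sq' (abs_le.1 h2).1 (abs_le.1 h2).2
    nlinarith
  rw [integral_sub (integrable_const _) (hl.const_mul ε), integral_const_mul] at h1
  simp only [integral_const, probReal_univ, one_smul] at h1
  refine h1.trans (le_trans (le_of_eq ?_) (Real.add_one_le_exp _))
  ring

/-- Chernoff bound for the false alarm probability of a test that accepts on a perturbation of the
walk with drift at most `δ`. -/
lemma error_le_exp (M : LLRModel P Q F l b) {τ : Ω → ℕ∞} {D : Set Ω} (h : IsTest F τ D)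
    {δ ε a : ℝ} (hδ : 0 ≤ δ) (hε : 0 ≤ ε) (hε1 : ε ≤ 1) (hεb : ε * b ≤ 1)
    (hεδ : δ ≤ ε * (∫ ω, l 0 ω ∂P) - ε ^ 2 * b ^ 2)
    (hD : ∀ᵐ ω ∂P, ∀ n : ℕ, τ ω = n → ω ∈ D → a ≤ walk l n ω + δ * n) :
    Q.real (D ∩ {ω | τ ω ≠ ⊤}) ≤ Real.exp (-((1 - ε) * a)) := by
  -- A supermartingale under `P`: only the fraction `ε` of the exponent is kept, and its drift pays
  -- for the error `δ` per step.
  let X : ℕ → Ω → ℝ := fun n ω => Real.exp (-(ε * walk l n ω) + (1 - ε) * δ * n)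
  have hXi : ∀ n, Integrable (X n) P := fun n =>
    M.integrable_comp (h := fun x => Real.exp (-(ε * x) + (1 - ε) * δ * n)) (by fun_prop) n
  have hmgf : Real.exp ((1 - ε) * δ) * ∫ ω, Real.exp (-(ε * l 0 ω)) ∂P ≤ 1 := by
    calc Real.exp ((1 - ε) * δ) * ∫ ω, Real.exp (-(ε * l 0 ω)) ∂P
        ≤ Real.exp ((1 - ε) * δ) * Real.exp (-(ε * ∫ ω, l 0 ω ∂P) + ε ^ 2 * b ^ 2) := by
          gcongr; exact M.integral_exp_le hε hεb
      _ = Real.exp ((1 - ε) * δ + (-(ε * ∫ ω, l 0 ω ∂P) + ε ^ 2 * b ^ 2)) :=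
          (Real.exp_add _ _).symm
      _ ≤ 1 := Real.exp_le_one_iff.2 (by nlinarith)
  have hstep : ∀ n : ℕ, ∫ ω in {ω | (n : ℕ∞) < τ ω}, X (n + 1) ω ∂P
      ≤ ∫ ω in {ω | (n : ℕ∞) < τ ω}, X n ω ∂P := by
    intro n
    have h1 : ∀ ω, X (n + 1) ω
        = Real.exp (-(ε * (walk l n ω + l n ω)) + (1 - ε) * δ * (n + 1 : ℕ)) := fun ω => by
      simp only [X, walk_succ]
    have key := M.setIntegral_step n (h.lt n) (M.measurable_walk n)
      (h := fun w s => Real.exp (-(ε * (w + s)) + (1 - ε) * δ * (n + 1 : ℕ)))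
      (by unfold Function.uncurry; fun_prop)
      ((hXi (n + 1)).congr (Eventually.of_forall h1))
    simp only [h1]
    rw [key]
    refine integral_mono_of_nonneg (Eventually.of_forall fun ω =>
      integral_nonneg fun s => (Real.exp_pos _).le) (hXi n).integrableOn
      (Eventually.of_forall fun ω => ?_)
    have h2 : ∀ s, Real.exp (-(ε * (walk l n ω + s)) + (1 - ε) * δ * (n + 1 : ℕ))
        = X n ω * (Real.exp ((1 - ε) * δ) * Real.exp (-(ε * s))) := fun s => by
      simp only [X, ← Real.exp_add]; congr 1; push_cast; ring
    simp only [h2]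
    rw [integral_const_mul, integral_const_mul, M.integral_law (h := fun s =>
      Real.exp (-(ε * s))) (by fun_prop)]
    exact mul_le_of_le_one_right (Real.exp_pos _).le hmgf
  have hX1 : ∀ N, ∫ ω, X (stopAt τ N ω) ω ∂P ≤ 1 := by
    intro N
    have := h.integral_le_stopped (X := fun n ω => -X n ω) (fun n => (hXi n).neg)
      (fun n => by simp only [integral_neg]; exact neg_le_neg (hstep n)) N
    simp only [integral_neg] at this
    have h0 : ∀ ω, X 0 ω = 1 := fun ω => by simp [X]
    simp only [h0, integral_const, probReal_univ, one_smul] at this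
    linarith
  -- Optional stopping is available at truncated times, so the bound is first proved on `{τ ≤ N}`.
  have hN : ∀ N : ℕ, Q.real (D ∩ {ω | τ ω ≤ N}) ≤ Real.exp (-((1 - ε) * a)) := by
    intro N
    have ht : IsTest F τ (D ∩ {ω | τ ω ≤ N}) := by
      refine ⟨h.meas_eq, fun n => ?_⟩
      have hs : D ∩ {ω | τ ω ≤ N} ∩ {ω | τ ω = n}
          = (D ∩ {ω | τ ω = n}) ∩ {_ω : Ω | (n : ℕ∞) ≤ N} := by
        ext ω
        simp only [Set.mem_inter_iff, Set.mem_ofPred_eq]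
        constructor
        · rintro ⟨⟨h1, h2⟩, h3⟩; exact ⟨⟨h1, h3⟩, h3 ▸ h2⟩
        · rintro ⟨⟨h1, h3⟩, h2⟩; exact ⟨⟨h1, h3 ▸ h2⟩, h3⟩
      rw [hs]
      exact (h.dec n).inter (MeasurableSet.const _)
    have hfin : D ∩ {ω | τ ω ≤ N} ∩ {ω | τ ω ≠ ⊤} = D ∩ {ω | τ ω ≤ N} := by
      refine Set.inter_eq_left.2 fun ω hω => ?_
      exact ne_top_of_le_ne_top (ENat.natCast_ne_top N) hω.2
    have hm := ht.measurableSet_inter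
    obtain ⟨hi, he⟩ := M.stopped_density (Q := Q) ht
    rw [hfin] at hm hi he
    have hXs := h.integrable_stopped hXi N
    rw [← he]
    calc ∫ ω in D ∩ {ω | τ ω ≤ N}, Real.exp (-walk l (τ ω).toNat ω) ∂P
        ≤ ∫ ω in D ∩ {ω | τ ω ≤ N}, Real.exp (-((1 - ε) * a)) * X (stopAt τ N ω) ω ∂P := by
          refine setIntegral_mono_on_ae hi (hXs.const_mul _).integrableOn hm ?_
          filter_upwards [hD] with ω hω hωD
          obtain ⟨n, hn⟩ := ENat.ne_top_iff_exists.1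
            (ne_top_of_le_ne_top (ENat.natCast_ne_top N) hωD.2)
          have hnN : n ≤ N := by
            have := hωD.2
            rw [Set.mem_ofPred_eq, ← hn] at this
            exact_mod_cast this
          have h4 := hω n hn.symm hωD.1
          rw [stopAt_of_le hn.symm hnN, ← hn, ENat.toNat_natCast]
          simp only [X, ← Real.exp_add]
          refine Real.exp_le_exp.2 ?_
          -- After cancellation this is `(1 - ε) * (a - δ * n - walk l n ω) ≤ 0`.
          nlinarith
      _ ≤ ∫ ω, Real.exp (-((1 - ε) * a)) * X (stopAt τ N ω) ω ∂P :=
          setIntegral_le_integral (hXs.const_mul _)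
            (Eventually.of_forall fun ω => mul_nonneg (Real.exp_pos _).le (Real.exp_pos _).le)
      _ ≤ Real.exp (-((1 - ε) * a)) := by
          rw [integral_const_mul]
          exact mul_le_of_le_one_right (Real.exp_pos _).le (hX1 N)
  have hU : D ∩ {ω | τ ω ≠ ⊤} = ⋃ N : ℕ, D ∩ {ω | τ ω ≤ N} := by
    ext ω
    simp only [Set.mem_inter_iff, Set.mem_ofPred_eq, Set.mem_iUnion, exists_and_left]
    refine and_congr_right fun _ => ⟨fun hω => ?_, fun ⟨N, hω⟩ =>
      ne_top_of_le_ne_top (ENat.natCast_ne_top N) hω⟩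
    obtain ⟨n, hn⟩ := ENat.ne_top_iff_exists.1 hω
    exact ⟨n, hn.symm.le⟩
  have hmono : Monotone fun N : ℕ => D ∩ {ω | τ ω ≤ N} := fun N N' hNN ω hω =>
    ⟨hω.1, le_trans (b := (N : ℕ∞)) hω.2 (by exact_mod_cast hNN)⟩
  rw [hU]
  refine ENNReal.toReal_le_of_le_ofReal (Real.exp_pos _).le ?_
  rw [hmono.measure_iUnion]
  refine iSup_le fun N => ?_
  rw [← ofReal_measureReal]
  exact ENNReal.ofReal_le_ofReal (hN N)

end LLRModel

/-- A statistic observed every `T` steps that follows the walk `l` up to an error of at most `δ`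
per step. -/
structure IsApprox (P : Measure Ω) (F : Filtration ℕ m) (l : ℕ → Ω → ℝ) (b : ℝ) (T : ℕ) (δ : ℝ)
    (Z : ℕ → Ω → ℝ) : Prop where
  meas : ∀ n, Measurable[F (T * n)] (Z n)
  zero : ∀ ω, Z 0 ω = 0
  step : ∀ᵐ ω ∂P, ∀ n, Z (n + 1) ω ≤ Z n ω + T * b
  close : ∀ᵐ ω ∂P, ∀ n, |Z n ω - walk l (T * n) ω| ≤ δ * (T * n : ℕ)

lemma mul_eq_natCast_iff {T : ℕ} (hT : 1 ≤ T) {x : ℕ∞} {n : ℕ} :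
    (T : ℕ∞) * x = n ↔ ∃ k : ℕ, x = k ∧ n = T * k := by
  induction x using ENat.recTopCoe with
  | top =>
    rw [ENat.mul_top (by exact_mod_cast (by omega : T ≠ 0))]
    simp [eq_comm]
  | coe k =>
    constructor
    · intro h; exact ⟨k, rfl, by exact_mod_cast h.symm⟩
    · rintro ⟨j, hj, rfl⟩; rw [hj]; push_cast; rfl

/-- Exit is a test for the filtration sampled every `T` steps; rescaling time makes it a test for
`F`. This admits the quantized scheme as a competitor of the SPRT. -/
lemma IsApprox.isTest {T : ℕ} (hT : 1 ≤ T) {δ : ℝ} {Z : ℕ → Ω → ℝ}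
    (h : IsApprox P F l b T δ Z) (A B : ℝ) :
    IsTest F (fun ω => (T : ℕ∞) * exitTime Z A B ω) (decideOne Z A B) := by
  let G : Filtration ℕ m := ⟨fun n => F (T * n),
    fun i j hij => F.mono (Nat.mul_le_mul_left T hij), fun n => F.le _⟩
  have hG : IsTest G (exitTime Z A B) (decideOne Z A B) := isTest_exitTime h.meas A B
  have hset : ∀ n : ℕ, {ω | (T : ℕ∞) * exitTime Z A B ω = n}
      = if T ∣ n then {ω | exitTime Z A B ω = (n / T : ℕ)} else ∅ := by
    intro n
    ext ω
    simp only [Set.mem_ofPred_eq, mul_eq_natCast_iff hT]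
    split_ifs with hd
    · obtain ⟨k, rfl⟩ := hd
      rw [Nat.mul_div_cancel_left k hT]
      constructor
      · rintro ⟨j, hj, hjk⟩
        rw [Nat.eq_of_mul_eq_mul_left hT hjk]; exact hj
      · intro hk; exact ⟨k, hk, rfl⟩
    · simp only [Set.mem_empty_iff_false, iff_false]
      rintro ⟨j, -, rfl⟩
      exact hd ⟨j, rfl⟩
  constructor
  · intro n
    rw [hset]
    split_ifs with hd
    · have := hG.meas_eq (n / T)
      change MeasurableSet[F (T * (n / T))] _ at this
      rwa [Nat.mul_div_cancel' hd] at this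
    · exact @MeasurableSet.empty _ (F n)
  · intro n
    rw [hset]
    split_ifs with hd
    · have := hG.dec (n / T)
      change MeasurableSet[F (T * (n / T))] _ at this
      rwa [Nat.mul_div_cancel' hd] at this
    · rw [Set.inter_empty]; exact @MeasurableSet.empty _ (F n)

namespace LLRModel

variable [IsProbabilityMeasure P] [IsProbabilityMeasure Q] {A B : ℝ}

omit [IsProbabilityMeasure Q] in
/-- Upper bound for the expected sample size of a test based on an approximate statistic. -/
lemma approx_expectedTime_le (M : LLRModel P Q F l b) {T : ℕ} (hT : 1 ≤ T) {δ : ℝ}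
    (hδ : δ < ∫ ω, l 0 ω ∂P) {Z : ℕ → Ω → ℝ} (h : IsApprox P F l b T δ Z) (hA : 0 < A) :
    expectedTime P (fun ω => (T : ℕ∞) * exitTime Z A B ω)
      ≤ ENNReal.ofReal ((A + T * b) / ((∫ ω, l 0 ω ∂P) - δ)) := by
  refine M.expectedTime_le (h.isTest hT A B) hT hδ ?_
  filter_upwards [h.step, h.close] with ω hs hc N
  have hb := M.bound_nonneg
  have hTN : stopAt (fun ω => (T : ℕ∞) * exitTime Z A B ω) (T * N) ω
      = T * stopAt (exitTime Z A B) N ω := by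
    by_cases hle : (N : ℕ∞) ≤ exitTime Z A B ω
    · rw [stopAt_of_lt hle, stopAt_of_lt]
      push_cast
      gcongr
    · rw [not_le] at hle
      obtain ⟨k, hk⟩ := ENat.ne_top_iff_exists.1 (ne_top_of_lt hle)
      rw [← hk] at hle
      have hkN : k ≤ N := by exact_mod_cast hle.le
      rw [stopAt_of_le hk.symm hkN, stopAt_of_le (n := T * k) _ (Nat.mul_le_mul_left T hkN)]
      rw [← hk]; push_cast; rfl
  rw [hTN]
  set k := stopAt (exitTime Z A B) N ω with hk
  have h1 := (abs_le.1 (hc k)).1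
  -- Before the last period the statistic is at most `A`, and one period adds at most `T * b`.
  have h2 : Z k ω ≤ A + T * b := by
    cases hj : k with
    | zero => rw [h.zero]; positivity
    | succ j =>
      have h3 := stopAt_le_self (exitTime Z A B) N ω
      rw [← hk, hj] at h3
      have h4 : (j : ℕ∞) < exitTime Z A B ω := lt_of_lt_of_le (by exact_mod_cast j.lt_succ_self) h3
      have h5 : Z j ω ≤ A := by
        rcases Nat.eq_zero_or_pos j with rfl | hj'
        · rw [h.zero]; exact hA.le
        · exact (mem_Ioo_of_lt_exitTime h4 hj').2.le
      linarith [hs j]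
  linarith

/-- Upper bound for the acceptance threshold of a test based on an approximate statistic. -/
lemma approx_threshold_le (M : LLRModel P Q F l b) {T : ℕ} (hT : 1 ≤ T) {δ ε : ℝ}
    {Z : ℕ → Ω → ℝ} (h : IsApprox P F l b T δ Z)
    (hδ : 0 ≤ δ) (hε : 0 ≤ ε) (hε1 : ε < 1) (hεb : ε * b ≤ 1)
    (hεδ : δ ≤ ε * (∫ ω, l 0 ω ∂P) - ε ^ 2 * b ^ 2) {α : ℝ} (hα0 : 0 < α)
    (hα : Q.real (decideOne Z A B) = α) : A ≤ -Real.log α / (1 - ε) := by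
  have key := M.error_le_exp (Q := Q) (a := A) (h.isTest hT A B) hδ hε hε1.le hεb hεδ (by
    filter_upwards [h.close] with ω hc n hn hD
    obtain ⟨k, hk, rfl⟩ := (mul_eq_natCast_iff hT).1 hn
    obtain ⟨j, hj, hA⟩ := hD
    rw [hk] at hj
    have : k = j := by exact_mod_cast hj
    subst this
    linarith [(abs_le.1 (hc k)).2])
  have hfin : decideOne Z A B ∩ {ω | (T : ℕ∞) * exitTime Z A B ω ≠ ⊤} = decideOne Z A B := by
    refine Set.inter_eq_left.2 ?_
    rintro ω ⟨n, hn, -⟩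
    rw [Set.mem_ofPred_eq, hn]
    exact_mod_cast ENat.natCast_ne_top (T * n)
  rw [hfin, hα] at key
  have := (Real.log_le_iff_le_exp hα0).2 key
  rw [le_div_iff₀ (by linarith)]
  linarith

end LLRModel

end Bounds

/-! ### Error terms and the abstract comparison. -/

section Asymptotics

/-- The exponent defect in the Chernoff bound for an approximation error `δ` per step. -/
def defect (μ b δ : ℝ) : ℝ := δ / μ + 4 * b ^ 2 / μ ^ 3 * δ ^ 2

/-- Relative error of the quantization term. -/
def quantError (μ b δ : ℝ) : ℝ :=
  μ / 2 * (2 + 4 * b ^ 2 / μ ^ 2 * δ - defect μ b δ) / ((1 - defect μ b δ) * (μ - δ)) - 1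

/-- Relative error of the sampling period term. -/
def periodError (μ δ : ℝ) : ℝ := μ / (μ - δ) - 1

variable {μ b δ : ℝ}

lemma tendsto_defect (μ b : ℝ) : Tendsto (defect μ b) (𝓝 0) (𝓝 0) := by
  have : ContinuousAt (defect μ b) 0 := by unfold defect; fun_prop
  simpa [ContinuousAt, defect] using this

lemma tendsto_quantError (hμ : 0 < μ) (b : ℝ) : Tendsto (quantError μ b) (𝓝 0) (𝓝 0) := by
  have h1 : ContinuousAt (defect μ b) 0 := by unfold defect; fun_prop
  have h0 : defect μ b 0 = 0 := by simp [defect]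
  have : ContinuousAt (quantError μ b) 0 := by
    unfold quantError
    refine ContinuousAt.sub (ContinuousAt.div (by fun_prop) (by fun_prop) ?_) continuousAt_const
    rw [h0]; simp [hμ.ne']
  have h2 : quantError μ b 0 = 0 := by
    simp only [quantError, h0, mul_zero, add_zero, sub_zero, one_mul]; field_simp; norm_num
  simpa [ContinuousAt, h2] using this

lemma tendsto_periodError (hμ : 0 < μ) : Tendsto (periodError μ) (𝓝 0) (𝓝 0) := by
  have : ContinuousAt (periodError μ) 0 := by
    unfold periodError
    refine ContinuousAt.sub (ContinuousAt.div (by fun_prop) (by fun_prop) ?_) continuousAt_const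
    simp [hμ.ne']
  have h2 : periodError μ 0 = 0 := by simp [periodError, hμ.ne']
  simpa [ContinuousAt, h2] using this

/-- The supermartingale needs `ε μ ≥ δ + ε² b²`. To first order `ε = δ / μ`; the quadratic term of
`defect` makes `ε μ = δ + (2 δ / μ)² b²`, which suffices because `ε ≤ 2 δ / μ`. -/
lemma le_defect (hμ : 0 < μ) (hδ : 0 ≤ δ) (hs : 4 * b ^ 2 / μ ^ 3 * δ ≤ 1 / μ) :
    δ ≤ defect μ b δ * μ - defect μ b δ ^ 2 * b ^ 2 := by
  have h1 : defect μ b δ ≤ 2 * δ / μ := by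
    have : 4 * b ^ 2 / μ ^ 3 * δ ^ 2 ≤ δ / μ := by
      calc 4 * b ^ 2 / μ ^ 3 * δ ^ 2 = 4 * b ^ 2 / μ ^ 3 * δ * δ := by ring
        _ ≤ 1 / μ * δ := by gcongr
        _ = δ / μ := by ring
    calc defect μ b δ ≤ δ / μ + δ / μ := by unfold defect; linarith
      _ = 2 * δ / μ := by ring
  have h0 : 0 ≤ defect μ b δ := by unfold defect; positivity
  have h2 : defect μ b δ ^ 2 * b ^ 2 ≤ (2 * δ / μ) ^ 2 * b ^ 2 := by gcongr
  have h3 : defect μ b δ * μ = δ + (2 * δ / μ) ^ 2 * b ^ 2 := by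
    unfold defect; field_simp; ring
  linarith

/-- The left side is the coefficient of `|log α|` in the difference of the bounds. The inflated
threshold and the reduced drift each contribute `δ / μ ^ 2` to first order. -/
lemma quantError_spec (hμ : 0 < μ) (hδ : 0 < δ) (hδμ : δ < μ) (hd : defect μ b δ < 1) :
    1 / ((1 - defect μ b δ) * (μ - δ)) - 1 / μ = 2 / μ ^ 2 * δ * (1 + quantError μ b δ) := by
  have h1 : 0 < 1 - defect μ b δ := by linarith
  have h2 : 0 < μ - δ := by linarith
  have h3 : defect μ b δ * μ = δ + 4 * b ^ 2 / μ ^ 2 * δ * δ := by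
    unfold defect; field_simp
  unfold quantError
  set d := defect μ b δ
  have h4 : 1 / ((1 - d) * (μ - δ)) - 1 / μ
      = (δ + d * μ - d * δ) / (μ * ((1 - d) * (μ - δ))) := by
    field_simp; ring
  rw [h4, h3]
  have h5 : 2 / μ ^ 2 * δ * (1 + (μ / 2 * (2 + 4 * b ^ 2 / μ ^ 2 * δ - d) / ((1 - d) * (μ - δ)) - 1))
      = (δ * (2 + 4 * b ^ 2 / μ ^ 2 * δ - d)) / (μ * ((1 - d) * (μ - δ))) := by
    set k := 4 * b ^ 2 / μ ^ 2
    field_simp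
    ring
  rw [h5]
  congr 1
  ring

variable {Ω : Type*} {m : MeasurableSpace Ω} {P Q : Measure Ω} {F : Filtration ℕ m}
  {l : ℕ → Ω → ℝ}

lemma measureReal_decideZero [IsProbabilityMeasure P] {Z : ℕ → Ω → ℝ} {A B : ℝ} (hAB : -B < A)
    (hfin : ∀ᵐ ω ∂P, exitTime Z A B ω ≠ ⊤) :
    P.real (decideZero Z A B) = P.real (decideOne Z A B)ᶜ := by
  refine measureReal_congr ?_
  filter_upwards [hfin] with ω hω
  exact propext (mem_decideZero_iff hAB hω)

/-- A walk without drift never accepts the hypothesis `H₁`. -/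
lemma LLRModel.measureReal_decideOne_eq_zero [IsProbabilityMeasure P] [IsProbabilityMeasure Q]
    (M : LLRModel P Q F l b) (h0 : l 0 =ᵐ[P] 0) {A B : ℝ} (hA : 0 < A) :
    Q.real (decideOne (walk l) A B) = 0 := by
  have hl : ∀ n, ∀ᵐ ω ∂P, l n ω = 0 := by
    intro n
    have h1 : ∀ᵐ s ∂(P.map (l n)), s = 0 := by
      rw [M.ident n]
      exact (ae_map_iff (M.measurable_inc 0).aemeasurable (measurableSet_singleton 0)).2 h0
    exact ae_of_ae_map (M.measurable_inc n).aemeasurable h1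
  have hP : P (decideOne (walk l) A B) = 0 := by
    rw [measure_eq_zero_iff_ae_notMem]
    filter_upwards [ae_all_iff.2 hl] with ω hω
    rintro ⟨n, -, hn⟩
    have : walk l n ω = 0 := Finset.sum_eq_zero fun i _ => hω i
    linarith
  have h := (M.stopped_density (Q := Q) (isTest_exitTime M.measurable_walk A B)).2
  rw [decideOne_inter_ne_top, Measure.restrict_eq_zero.2 hP, integral_zero_measure] at h
  exact h.symm

/-- The comparison of the expected sample sizes of the sequential probability ratio test and of a
test with the same error probabilities that is based on an approximate statistic. -/
theorem LLRModel.compare [IsProbabilityMeasure P] [IsProbabilityMeasure Q]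
    (M : LLRModel P Q F l b) (hμ : 0 < ∫ ω, l 0 ω ∂P) (hδ : 0 < δ) (hδμ : δ < ∫ ω, l 0 ω ∂P)
    (hd : defect (∫ ω, l 0 ω ∂P) b δ < 1) (hdb : defect (∫ ω, l 0 ω ∂P) b δ * b ≤ 1)
    (hs : 4 * b ^ 2 / (∫ ω, l 0 ω ∂P) ^ 3 * δ ≤ 1 / ∫ ω, l 0 ω ∂P)
    {α β A B A' B' : ℝ} (hα0 : 0 < α) (hβ0 : 0 < β) (hA : 0 < A) (hB : 0 < B) (hA' : 0 < A')
    (hB' : 0 < B') {T : ℕ} (hT : 1 ≤ T) {Z : ℕ → Ω → ℝ} (h : IsApprox P F l b T δ Z)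
    (hα : Q.real (decideOne (walk l) A B) = α) (hβ : P.real (decideZero (walk l) A B) = β)
    (hα' : Q.real (decideOne Z A' B') = α) (hβ' : P.real (decideZero Z A' B') = β) :
    expectedTime P (exitTime (walk l) A B) ≠ ⊤ ∧
    expectedTime P (fun ω => (T : ℕ∞) * exitTime Z A' B' ω) ≠ ⊤ ∧
    0 ≤ (expectedTime P (fun ω => (T : ℕ∞) * exitTime Z A' B' ω)).toReal
      - (expectedTime P (exitTime (walk l) A B)).toReal ∧
    (expectedTime P (fun ω => (T : ℕ∞) * exitTime Z A' B' ω)).toReal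
      - (expectedTime P (exitTime (walk l) A B)).toReal
      ≤ -Real.log α * (2 / (∫ ω, l 0 ω ∂P) ^ 2 * δ * (1 + quantError (∫ ω, l 0 ω ∂P) b δ))
        + T * (b / ∫ ω, l 0 ω ∂P) * (1 + periodError (∫ ω, l 0 ω ∂P) δ)
        + β * (1 - Real.log α - Real.log β) / ∫ ω, l 0 ω ∂P := by
  set μ := ∫ ω, l 0 ω ∂P with hμdef
  have ht : IsTest F (exitTime (walk l) A B) (decideOne (walk l) A B) :=
    isTest_exitTime M.measurable_walk A B
  have ht' := h.isTest hT A' B'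
  have hE : expectedTime P (exitTime (walk l) A B) ≠ ⊤ := by
    have := M.expectedTime_exit_ne_top (x := 0) (A := A) (B := B) hμ ⟨by linarith, hA.le⟩
    simpa only [zero_add] using this
  have hE'le := M.approx_expectedTime_le (A := A') (B := B') hT hδμ h hA'
  have hE' := ne_top_of_le_ne_top ENNReal.ofReal_ne_top hE'le
  have hfin := ne_top_of_expectedTime ht.measurable_time hE
  have hfin' := ne_top_of_expectedTime ht'.measurable_time hE'
  have hfinZ : ∀ᵐ ω ∂P, exitTime Z A' B' ω ≠ ⊤ := by
    filter_upwards [hfin'] with ω hω hc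
    rw [hc, ENat.mul_top (by exact_mod_cast (by omega : T ≠ 0))] at hω
    exact hω rfl
  rw [measureReal_decideZero (by linarith) hfin] at hβ
  rw [measureReal_decideZero (by linarith) hfinZ] at hβ'
  have hDset : decideOne Z A' B' ∩ {ω | (T : ℕ∞) * exitTime Z A' B' ω ≠ ⊤} = decideOne Z A' B' := by
    refine Set.inter_eq_left.2 ?_
    rintro ω ⟨n, hn, -⟩
    rw [Set.mem_ofPred_eq, hn]
    exact_mod_cast ENat.natCast_ne_top (T * n)
  -- The quantized test is the competitor in the optimality theorem.
  have hWW := M.wald_wolfowitz hμ hA hB ht' hE' (Q := Q)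
    (by rw [hDset, hα', hα]) (by rw [hDset, hβ', hβ])
  refine ⟨hE, hE', ?_, ?_⟩
  · rw [(expectedTime_eq_integral ht.measurable_time hE).2,
      (expectedTime_eq_integral ht'.measurable_time hE').2]
    exact sub_nonneg.2 hWW
  have hlow := M.sprt_lower_bound hμ hA hB hα0 hβ0 hα hβ
  rw [← (expectedTime_eq_integral ht.measurable_time hE).2, ← hμdef] at hlow
  have hd0 : 0 ≤ defect μ b δ := by unfold defect; positivity
  have hA'le := M.approx_threshold_le (Q := Q) hT h hδ.le hd0 hd hdb (le_defect hμ hδ.le hs) hα0 hα'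
  have hμδ : 0 < μ - δ := by linarith
  have hb := M.bound_nonneg
  have hup : (expectedTime P (fun ω => (T : ℕ∞) * exitTime Z A' B' ω)).toReal
      ≤ (A' + T * b) / (μ - δ) :=
    ENNReal.toReal_le_of_le_ofReal (by positivity) hE'le
  have hup2 : (A' + T * b) / (μ - δ)
      ≤ -Real.log α * (1 / ((1 - defect μ b δ) * (μ - δ))) + T * (b / (μ - δ)) := by
    calc (A' + T * b) / (μ - δ) ≤ (-Real.log α / (1 - defect μ b δ) + T * b) / (μ - δ) := by
          gcongr
      _ = _ := by
          have : 1 - defect μ b δ ≠ 0 := by linarith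
          field_simp
  have hper : T * (b / μ) * (1 + periodError μ δ) = T * (b / (μ - δ)) := by
    unfold periodError; field_simp; ring
  have hlow2 : -Real.log α / μ - β * (1 - Real.log α - Real.log β) / μ
      ≤ (expectedTime P (exitTime (walk l) A B)).toReal := by
    rw [← sub_div, div_le_iff₀ hμ]; linarith
  have hq := quantError_spec (b := b) hμ hδ hδμ hd
  rw [← hq, hper]
  have : -Real.log α * (1 / ((1 - defect μ b δ) * (μ - δ)) - 1 / μ)
      = -Real.log α * (1 / ((1 - defect μ b δ) * (μ - δ))) - -Real.log α / μ := by ring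
  rw [this]
  linarith

/-- Comparable rates replace `β` by `C α` and `-log β` by `log C - log α`; what remains is a
multiple of `α` and `α log α`, both tending to 0. -/
lemma exists_remainder (hμ : 0 < μ) (C : ℝ) : ∃ η : ℝ → ℝ, Tendsto η (𝓝[>] 0) (𝓝 0) ∧
    ∀ α β : ℝ, 0 < α → α < 1 → 0 < β → α ≤ C * β → β ≤ C * α →
      β * (1 - Real.log α - Real.log β) / μ ≤ η α := by
  refine ⟨fun α => C * (α * (1 + |Real.log C|) - 2 * (α * Real.log α)) / μ, ?_, ?_⟩
  · have hc : Continuous fun α : ℝ => C * (α * (1 + |Real.log C|) - 2 * (α * Real.log α)) / μ := by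
      have := Real.continuous_mul_log
      fun_prop
    have := (hc.tendsto 0).mono_left (nhdsWithin_le_nhds (s := Set.Ioi 0))
    simpa using this
  · intro α β hα hα1 hβ h1 h2
    have hC : 0 < C := by
      by_contra hc
      have : C * β ≤ 0 := mul_nonpos_of_nonpos_of_nonneg (not_lt.1 hc) hβ.le
      linarith
    have h3 : Real.log α ≤ Real.log C + Real.log β := by
      rw [← Real.log_mul hC.ne' hβ.ne']; exact Real.log_le_log hα h1
    have h4 : Real.log α < 0 := Real.log_neg hα hα1
    have h5 := le_abs_self (Real.log C)
    have h6 : 1 - Real.log α - Real.log β ≤ 1 + |Real.log C| - 2 * Real.log α := by linarith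
    have h7 : 0 ≤ 1 + |Real.log C| - 2 * Real.log α := by
      have := abs_nonneg (Real.log C); linarith
    refine div_le_div_of_nonneg_right ?_ hμ.le
    calc β * (1 - Real.log α - Real.log β) ≤ β * (1 + |Real.log C| - 2 * Real.log α) := by gcongr
      _ ≤ C * α * (1 + |Real.log C| - 2 * Real.log α) := by gcongr
      _ = C * (α * (1 + |Real.log C|) - 2 * (α * Real.log α)) := by ring

/-- The asymptotic comparison under one hypothesis, uniformly in the period and the thresholds. -/
theorem LLRModel.asymptotics [IsProbabilityMeasure P] [IsProbabilityMeasure Q]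
    (M : LLRModel P Q F l b) (hb : 0 < b) :
    ∃ ε ε' : ℕ → ℝ, Tendsto ε atTop (𝓝 0) ∧ Tendsto ε' atTop (𝓝 0) ∧ ∃ r₀ : ℕ, 1 ≤ r₀ ∧ ∀ C : ℝ,
    ∃ η : ℝ → ℝ, Tendsto η (𝓝[>] 0) (𝓝 0) ∧
    ∀ α β : ℝ, 0 < α → α < 1 → 0 < β → α ≤ C * β → β ≤ C * α →
    ∀ T r : ℕ, 1 ≤ T → r₀ ≤ r → ∀ A B A' B' : ℝ, 0 < A → 0 < B → 0 < A' → 0 < B' →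
    ∀ Z : ℕ → Ω → ℝ, IsApprox P F l b T (b / r) Z →
      Q.real (decideOne (walk l) A B) = α → P.real (decideZero (walk l) A B) = β →
      Q.real (decideOne Z A' B') = α → P.real (decideZero Z A' B') = β →
      expectedTime P (exitTime (walk l) A B) ≠ ⊤ ∧
      expectedTime P (fun ω => (T : ℕ∞) * exitTime Z A' B' ω) ≠ ⊤ ∧
      0 ≤ (expectedTime P (fun ω => (T : ℕ∞) * exitTime Z A' B' ω)).toReal
        - (expectedTime P (exitTime (walk l) A B)).toReal ∧
      (expectedTime P (fun ω => (T : ℕ∞) * exitTime Z A' B' ω)).toReal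
        - (expectedTime P (exitTime (walk l) A B)).toReal
        ≤ |Real.log α| * (2 / (∫ ω, l 0 ω ∂P) ^ 2 * (b / r) * (1 + ε r))
          + T * (b / |∫ ω, l 0 ω ∂P|) * (1 + ε' r) + η α := by
  -- Without drift the SPRT never accepts `H₁`, which contradicts `α > 0`.
  by_cases h0 : l 0 =ᵐ[P] 0
  · refine ⟨0, 0, tendsto_const_nhds, tendsto_const_nhds, 1, le_rfl, fun C => ⟨0,
      tendsto_const_nhds, fun α β hα _ _ _ _ T r _ _ A B A' B' hA _ _ _ Z _ hα' => ?_⟩⟩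
    rw [M.measureReal_decideOne_eq_zero h0 hA] at hα'
    exact absurd hα' hα.ne
  have hμ := M.drift_pos (Q := Q) h0
  rw [abs_of_pos hμ]
  have hlim : Tendsto (fun r : ℕ => b / r) atTop (𝓝 0) := tendsto_const_div_atTop_nhds_zero_nat b
  have hdef := (tendsto_defect (∫ ω, l 0 ω ∂P) b).comp hlim
  have e1 : ∀ᶠ r : ℕ in atTop, b / r < ∫ ω, l 0 ω ∂P := hlim.eventually_lt_const hμ
  have e2 : ∀ᶠ r : ℕ in atTop, defect (∫ ω, l 0 ω ∂P) b (b / r) < 1 :=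
    hdef.eventually_lt_const zero_lt_one
  have e3 : ∀ᶠ r : ℕ in atTop, defect (∫ ω, l 0 ω ∂P) b (b / r) * b < 1 := by
    have := hdef.mul_const b
    rw [zero_mul] at this
    exact this.eventually_lt_const zero_lt_one
  have e4 : ∀ᶠ r : ℕ in atTop, 4 * b ^ 2 / (∫ ω, l 0 ω ∂P) ^ 3 * (b / r) < 1 / ∫ ω, l 0 ω ∂P := by
    have := hlim.const_mul (4 * b ^ 2 / (∫ ω, l 0 ω ∂P) ^ 3)
    rw [mul_zero] at this
    exact this.eventually_lt_const (by positivity)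
  obtain ⟨r₀, hr₀⟩ := eventually_atTop.1 (e1.and (e2.and (e3.and (e4.and (eventually_ge_atTop 1)))))
  refine ⟨fun r => quantError (∫ ω, l 0 ω ∂P) b (b / r), fun r => periodError (∫ ω, l 0 ω ∂P) (b / r),
    (tendsto_quantError hμ b).comp hlim, (tendsto_periodError hμ).comp hlim, r₀,
    (hr₀ r₀ le_rfl).2.2.2.2, fun C => ?_⟩
  obtain ⟨η, hη, hηle⟩ := exists_remainder hμ C
  refine ⟨η, hη, fun α β hα hα1 hβ h1 h2 T r hT hr A B A' B' hA hB hA' hB' Z hZ hα2 hβ2 hα3 hβ3 => ?_⟩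
  obtain ⟨g1, g2, g3, g4, g5⟩ := hr₀ r hr
  have hrpos : (0 : ℝ) < r := by exact_mod_cast g5
  obtain ⟨c1, c2, c3, c4⟩ := M.compare hμ (by positivity) g1 g2 g3.le g4.le hα hβ hA hB hA' hB' hT hZ
    hα2 hβ2 hα3 hβ3
  refine ⟨c1, c2, c3, c4.trans ?_⟩
  rw [abs_of_neg (Real.log_neg hα hα1)]
  linarith [hηle α β hα hα1 hβ h1 h2]

end Asymptotics

/-! ### From sensor observations to the abstract model. -/

section Observations

variable {Ω : Type*} [m : MeasurableSpace Ω] {K : ℕ} {Y : Fin K → Type*}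
  [∀ k, MeasurableSpace (Y k)] {f₀ f₁ : ∀ k, Y k → ℝ} {y : ∀ k, ℕ → Ω → Y k} {φ : ℝ}

/-- The information contained in the observations up to time `n`. -/
def obsFiltration (y : ∀ k, ℕ → Ω → Y k) (hy : ∀ k t, Measurable (y k t)) : Filtration ℕ m where
  seq n := ⨆ p ∈ {p : Fin K × ℕ | p.2 < n}, MeasurableSpace.comap (y p.1 p.2) inferInstance
  mono' _ _ hij := biSup_mono fun _ hp => lt_of_lt_of_le hp hij
  le' _ := iSup₂_le fun p _ => (hy p.1 p.2).comap_le

lemma measurable_obs (hy : ∀ k t, Measurable (y k t)) {k : Fin K} {t n : ℕ} (h : t < n) :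
    Measurable[obsFiltration y hy n] (y k t) := by
  rw [measurable_iff_comap_le]
  exact le_iSup₂_of_le (f := fun (p : Fin K × ℕ) (_ : p ∈ {p : Fin K × ℕ | p.2 < n}) =>
    MeasurableSpace.comap (y p.1 p.2) inferInstance) (k, t) h le_rfl

/-- The increment of the global log-likelihood ratio at time `t`. -/
def globalIncrement (f₀ f₁ : ∀ k, Y k → ℝ) (y : ∀ k, ℕ → Ω → Y k) (t : ℕ) (ω : Ω) : ℝ :=
  ∑ k, llrIncrement f₀ f₁ y k t ω

omit m [∀ k, MeasurableSpace (Y k)] in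
lemma globalLLR_eq_walk : globalLLR f₀ f₁ y = walk (globalIncrement f₀ f₁ y) := by
  funext t ω
  simp only [globalLLR, localLLR, walk, globalIncrement]
  exact Finset.sum_comm

omit m [∀ k, MeasurableSpace (Y k)] in
lemma llrIncrement_swap (k : Fin K) (t : ℕ) (ω : Ω) :
    llrIncrement f₁ f₀ y k t ω = -llrIncrement f₀ f₁ y k t ω := by
  rw [llrIncrement, llrIncrement, ← Real.log_inv, inv_div]

variable {ν : ∀ k, Measure (Y k)} {P₀ P₁ : Measure Ω}

/-- Change of measure for one observation. -/
lemma lintegral_llr_eq {X : Type*} [MeasurableSpace X] {ν : Measure X} {f₀ f₁ : X → ℝ}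
    (hf₀ : IsDensity ν f₀) (hf₁ : IsDensity ν f₁)
    (h₀ : ∀ᵐ x ∂(ν.withDensity fun x => ENNReal.ofReal (f₀ x)), 0 < f₁ x)
    (h₁ : ∀ᵐ x ∂(ν.withDensity fun x => ENNReal.ofReal (f₁ x)), 0 < f₀ x)
    {A : Set X} (hA : MeasurableSet A) :
    ∫⁻ x in A, ENNReal.ofReal (Real.exp (-Real.log (f₁ x / f₀ x)))
        ∂(ν.withDensity fun x => ENNReal.ofReal (f₁ x))
      = (ν.withDensity fun x => ENNReal.ofReal (f₀ x)) A := by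
  have hm₀ := hf₀.1
  have hm₁ := hf₁.1
  rw [withDensity_apply _ hA, restrict_withDensity hA,
    lintegral_withDensity_eq_lintegral_mul _ (by fun_prop) (by fun_prop)]
  refine lintegral_congr_ae (ae_restrict_of_ae ?_)
  rw [ae_withDensity_iff (by fun_prop)] at h₀ h₁
  filter_upwards [h₀, h₁] with x hx₀ hx₁
  simp only [ne_eq, ENNReal.ofReal_eq_zero, not_le, Pi.mul_apply] at hx₀ hx₁ ⊢
  -- Where `f₁` vanishes, so does `f₀`, and both integrands are 0.
  rcases (hf₁.2.1 x).eq_or_lt with h | h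
  · have : ¬ 0 < f₀ x := fun hc => (hx₀ hc).ne h
    rw [← h, ENNReal.ofReal_zero, zero_mul, ENNReal.ofReal_of_nonpos (not_lt.1 this)]
  · rw [← ENNReal.ofReal_mul h.le, ← Real.log_inv, Real.exp_log (inv_pos.2 (div_pos h (hx₁ h))),
      inv_div, mul_div_cancel₀ _ h.ne']

/-- The likelihood ratio of the observations up to time `n`. -/
lemma measure_eq_lintegral_walk [IsProbabilityMeasure P₀] [IsProbabilityMeasure P₁]
    (hf₀ : ∀ k, IsDensity (ν k) (f₀ k)) (hf₁ : ∀ k, IsDensity (ν k) (f₁ k))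
    (hy : ∀ k t, Measurable (y k t))
    (hP₀ : ObservationLaw ν f₀ y P₀) (hP₁ : ObservationLaw ν f₁ y P₁)
    (h₀ : ∀ k t, ∀ᵐ ω ∂P₀, 0 < f₁ k (y k t ω)) (h₁ : ∀ k t, ∀ᵐ ω ∂P₁, 0 < f₀ k (y k t ω))
    (n : ℕ) {G : Set Ω} (hG : MeasurableSet[obsFiltration y hy n] G) :
    P₀ G = ∫⁻ ω in G, ENNReal.ofReal (Real.exp (-walk (globalIncrement f₀ f₁ y) n ω)) ∂P₁ := by
  classical
  have hlm : ∀ k, Measurable fun x : Y k => ENNReal.ofReal (Real.exp (-Real.log (f₁ k x / f₀ k x))) :=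
    fun k => by have := (hf₀ k).1; have := (hf₁ k).1; fun_prop
  set d : Ω → ℝ≥0∞ := fun ω => ENNReal.ofReal (Real.exp (-walk (globalIncrement f₀ f₁ y) n ω))
  have hd : ∀ ω, d ω = ∏ p ∈ Finset.univ ×ˢ Finset.range n,
      ENNReal.ofReal (Real.exp (-llrIncrement f₀ f₁ y p.1 p.2 ω)) := by
    intro ω
    rw [← ENNReal.ofReal_prod_of_nonneg fun _ _ => (Real.exp_pos _).le, ← Real.exp_sum,
      Finset.sum_product_right, Finset.sum_congr rfl fun t _ => Finset.sum_neg_distrib _,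
      Finset.sum_neg_distrib]
    rfl
  have hsingle : ∀ (p : Fin K × ℕ) {A : Set (Y p.1)}, MeasurableSet A →
      ∫⁻ ω, A.indicator (fun x => ENNReal.ofReal (Real.exp (-Real.log (f₁ p.1 x / f₀ p.1 x))))
        (y p.1 p.2 ω) ∂P₁ = P₀ (y p.1 p.2 ⁻¹' A) := by
    intro p A hA
    rw [← lintegral_map ((hlm p.1).indicator hA) (hy p.1 p.2), lintegral_indicator hA,
      ← Measure.map_apply (hy p.1 p.2) hA, hP₀.1, hP₁.1]
    have e₀ := (hP₀.1 p.1 p.2)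
    have e₁ := (hP₁.1 p.1 p.2)
    refine lintegral_llr_eq (hf₀ _) (hf₁ _) ?_ ?_ hA
    · rw [← e₀, ae_map_iff (hy _ _).aemeasurable (measurableSet_lt measurable_const (hf₁ _).1)]
      exact h₀ _ _
    · rw [← e₁, ae_map_iff (hy _ _).aemeasurable (measurableSet_lt measurable_const (hf₀ _).1)]
      exact h₁ _ _
  -- Boxes of finitely many observations form a π-system generating the past; on a box, independence
  -- splits the integral of the density into one factor per observation.
  set C := piiUnionInter (fun p : Fin K × ℕ =>
    {s | MeasurableSet[MeasurableSpace.comap (y p.1 p.2) inferInstance] s}) {p | p.2 < n}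
  have hbox : ∀ s ∈ C, P₀ s = ∫⁻ ω in s, d ω ∂P₁ := by
    rintro s ⟨t, hts, f, hf, rfl⟩
    have hex : ∀ p, ∃ A : Set (Y p.1), MeasurableSet A ∧
        y p.1 p.2 ⁻¹' A = if p ∈ t then f p else Set.univ := by
      intro p
      by_cases hp : p ∈ t
      · obtain ⟨A, hA, hAf⟩ := hf p hp
        exact ⟨A, hA, by rw [if_pos hp, hAf]⟩
      · exact ⟨Set.univ, MeasurableSet.univ, by rw [if_neg hp]; rfl⟩
    choose A hA hAf using hex
    have hset : ⋂ p ∈ t, f p = ⋂ p ∈ Finset.univ ×ˢ Finset.range n, y p.1 p.2 ⁻¹' A p := by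
      ext ω
      simp only [Set.mem_iInter, hAf]
      constructor
      · intro h p _
        by_cases hp : p ∈ t
        · rw [if_pos hp]; exact h p hp
        · rw [if_neg hp]; trivial
      · intro h p hp
        have := h p (Finset.mem_product.2 ⟨Finset.mem_univ _, Finset.mem_range.2 (hts hp)⟩)
        rwa [if_pos hp] at this
    have hsm : MeasurableSet (⋂ p ∈ t, f p) := by
      rw [hset]
      exact Finset.measurableSet_biInter _ fun p _ => hy _ _ (hA p)
    rw [← lintegral_indicator hsm]
    have hprod : ∀ ω, (⋂ p ∈ t, f p).indicator d ω = ∏ p ∈ Finset.univ ×ˢ Finset.range n,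
        (A p).indicator (fun x => ENNReal.ofReal (Real.exp (-Real.log (f₁ p.1 x / f₀ p.1 x))))
          (y p.1 p.2 ω) := by
      intro ω
      rw [hset]
      by_cases hω : ω ∈ ⋂ p ∈ Finset.univ ×ˢ Finset.range n, y p.1 p.2 ⁻¹' A p
      · rw [Set.indicator_of_mem hω, hd]
        refine Finset.prod_congr rfl fun p hp => ?_
        have hpω : y p.1 p.2 ω ∈ A p := Set.mem_iInter₂.1 hω p hp
        rw [Set.indicator_of_mem hpω]
        rfl
      · rw [Set.indicator_of_notMem hω]
        simp only [Set.mem_iInter, not_forall] at hω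
        obtain ⟨p, hp, hpω⟩ := hω
        have hpω' : y p.1 p.2 ω ∉ A p := hpω
        exact (Finset.prod_eq_zero hp (Set.indicator_of_notMem hpω' _)).symm
    simp only [hprod]
    have hind := hP₁.2.comp (fun p => (A p).indicator
      (fun x => ENNReal.ofReal (Real.exp (-Real.log (f₁ p.1 x / f₀ p.1 x)))))
      fun p => (hlm p.1).indicator (hA p)
    have hl := lintegral_prod_eq_prod_lintegral_of_indepFun (Finset.univ ×ˢ Finset.range n) _ hind
      fun p => ((hlm p.1).indicator (hA p)).comp (hy p.1 p.2)
    simp only [Function.comp_apply] at hl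
    rw [hl, hset, hP₀.2.meas_biInter fun p _ => ⟨A p, hA p, rfl⟩]
    exact Finset.prod_congr rfl fun p _ => (hsingle p (hA p)).symm
  have huniv : P₀ Set.univ = ∫⁻ ω in Set.univ, d ω ∂P₁ :=
    hbox _ ⟨∅, by simp, fun _ => Set.univ, by simp, by simp⟩
  have hle := (obsFiltration y hy).le n
  have : IsFiniteMeasure (P₀.trim hle) := isFiniteMeasure_trim hle
  -- The two measures are identified only on the past up to time `n`, hence the trimming.
  have key : P₀.trim hle = (P₁.withDensity d).trim hle := by
    refine @ext_of_generate_finite _ (obsFiltration y hy n) _ _ C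
      (generateFrom_piiUnionInter_measurableSet _ _).symm
      (isPiSystem_piiUnionInter _ (fun p : Fin K × ℕ => @MeasurableSpace.isPiSystem_measurableSet _
        (MeasurableSpace.comap (y p.1 p.2) inferInstance)) _) _ (fun s hs => ?_) ?_
    · have hsF : MeasurableSet[obsFiltration y hy n] s :=
        measurableSet_iSup_of_mem_piiUnionInter _ _ s hs
      rw [trim_measurableSet_eq hle hsF, trim_measurableSet_eq hle hsF,
        withDensity_apply _ (hle _ hsF)]
      exact hbox s hs
    · rw [trim_measurableSet_eq hle MeasurableSet.univ, trim_measurableSet_eq hle MeasurableSet.univ,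
        withDensity_apply _ MeasurableSet.univ]
      exact huniv
  have h := congrArg (fun μ => μ G) key
  simp only [trim_measurableSet_eq hle hG, withDensity_apply _ (hle _ hG)] at h
  exact h

lemma measurable_llrIncrement (hf₀ : ∀ k, Measurable (f₀ k)) (hf₁ : ∀ k, Measurable (f₁ k))
    (hy : ∀ k t, Measurable (y k t)) (k : Fin K) {t n : ℕ} (h : t < n) :
    Measurable[obsFiltration y hy n] (llrIncrement f₀ f₁ y k t) :=
  (((hf₁ k).div (hf₀ k)).log).comp (measurable_obs hy h)

/-- The observations form a log-likelihood ratio model. -/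
lemma llrModel [IsProbabilityMeasure P₀] [IsProbabilityMeasure P₁]
    (hf₀ : ∀ k, IsDensity (ν k) (f₀ k)) (hf₁ : ∀ k, IsDensity (ν k) (f₁ k))
    (hy : ∀ k t, Measurable (y k t))
    (hP₀ : ObservationLaw ν f₀ y P₀) (hP₁ : ObservationLaw ν f₁ y P₁)
    (h₀ : ∀ k t, ∀ᵐ ω ∂P₀, 0 < f₁ k (y k t ω))
    (h₁ : ∀ k t, ∀ᵐ ω ∂P₁, 0 < f₀ k (y k t ω) ∧ |llrIncrement f₀ f₁ y k t ω| < φ) :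
    LLRModel P₁ P₀ (obsFiltration y hy) (globalIncrement f₀ f₁ y) (K * φ) where
  adapted n := Finset.measurable_sum _ fun k _ =>
    measurable_llrIncrement (fun k => (hf₀ k).1) (fun k => (hf₁ k).1) hy k n.lt_succ_self
  indep n := by
    have hind := indep_iSup_of_disjoint (m := fun p : Fin K × ℕ =>
      MeasurableSpace.comap (y p.1 p.2) inferInstance) (fun p => (hy p.1 p.2).comap_le) hP₁.2
      (S := {p | p.2 = n}) (T := {p | p.2 < n})
      (Set.disjoint_left.2 fun p hp hq => absurd hp (ne_of_lt hq))
    refine indep_of_indep_of_le_left hind (Measurable.comap_le ?_)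
    refine Finset.measurable_sum _ fun k _ => ?_
    have hk : Measurable[⨆ p ∈ {p : Fin K × ℕ | p.2 = n},
        MeasurableSpace.comap (y p.1 p.2) inferInstance] (y k n) := by
      rw [measurable_iff_comap_le]
      exact le_iSup₂_of_le (f := fun (p : Fin K × ℕ) (_ : p ∈ {p : Fin K × ℕ | p.2 = n}) =>
        MeasurableSpace.comap (y p.1 p.2) inferInstance) (k, n) rfl le_rfl
    exact (((hf₁ k).1.div (hf₀ k).1).log).comp hk
  ident n := by
    let g : (∀ k, Y k) → ℝ := fun x => ∑ k, Real.log (f₁ k (x k) / f₀ k (x k))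
    have hg : Measurable g := Finset.measurable_sum _ fun k _ =>
      (((hf₁ k).1.div (hf₀ k).1).log).comp (measurable_pi_apply k)
    -- The observations at time `n` have a product law free of `n`, and the increment is a fixed
    -- function of them.
    have hlaw : ∀ n, P₁.map (globalIncrement f₀ f₁ y n)
        = (Measure.pi fun k => (ν k).withDensity fun x => ENNReal.ofReal (f₁ k x)).map g := by
      intro n
      have hind : iIndepFun (fun k => y k n) P₁ :=
        hP₁.2.precomp (g := fun k : Fin K => (k, n)) fun i j hij => (Prod.ext_iff.1 hij).1
      have hmap := (iIndepFun_iff_map_fun_eq_pi_map fun k => (hy k n).aemeasurable).1 hind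
      simp only [hP₁.1] at hmap
      rw [← hmap, Measure.map_map hg (measurable_pi_lambda _ fun k => hy k n)]
      rfl
    rw [hlaw n, hlaw 0]
  bound n := by
    filter_upwards [ae_all_iff.2 fun k => h₁ k n] with ω hω
    refine (Finset.abs_sum_le_sum_abs _ _).trans
      ((Finset.sum_le_sum fun k _ => (hω k).2.le).trans ?_)
    simp
  density n G hG := by
    have h := measure_eq_lintegral_walk hf₀ hf₁ hy hP₀ hP₁ h₀ (fun k t => (h₁ k t).mono
      fun ω hω => hω.1) n hG
    have hm : Measurable (walk (globalIncrement f₀ f₁ y) n) :=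
      Finset.measurable_sum _ fun t _ => Finset.measurable_sum _ fun k _ =>
        (measurable_llrIncrement (fun k => (hf₀ k).1) (fun k => (hf₁ k).1) hy k
          t.lt_succ_self).mono ((obsFiltration y hy).le _) le_rfl
    rw [measureReal_def, h, integral_eq_lintegral_of_nonneg_ae
      (Eventually.of_forall fun ω => (Real.exp_pos _).le) (by fun_prop)]

end Observations

/-! ### Quantization error and boundedness. -/

section Quantizer

/-- The output is the midpoint of the cell containing `x`, so the error is at most half a cell. This
holds for every `x`, even outside the nominal range. -/
lemma abs_quantize_sub_le {φ : ℝ} (hφ : 0 < φ) {T r : ℕ} (hT : 1 ≤ T) (hr : 1 ≤ r) (x : ℝ) :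
    |quantize φ T r x - x| ≤ T * φ / r := by
  have hT' : (0 : ℝ) < T := by exact_mod_cast hT
  have hr' : (0 : ℝ) < r := by exact_mod_cast hr
  have h : quantize φ T r x - x
      = T * φ / r * (1 - 2 * Int.fract (r * (x + T * φ) / (2 * (T * φ)))) := by
    unfold quantize
    rw [← Int.self_sub_floor]
    generalize (⌊r * (x + T * φ) / (2 * (T * φ))⌋ : ℝ) = z
    field_simp
    ring
  rw [h, abs_mul, abs_of_pos (by positivity)]
  refine mul_le_of_le_one_right (by positivity) (abs_le.2 ?_)
  have h0 := Int.fract_nonneg (r * (x + T * φ) / (2 * (T * φ)))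
  have h1 := Int.fract_lt_one (r * (x + T * φ) / (2 * (T * φ)))
  constructor <;> linarith

/-- For `x` strictly inside the range the floor lies between `0` and `r - 1`; strictness excludes
the value `r`. Quantization thus does not enlarge the overshoot bound. -/
lemma abs_quantize_le {φ : ℝ} (hφ : 0 < φ) {T r : ℕ} (hT : 1 ≤ T) (hr : 1 ≤ r) {x : ℝ}
    (hx : |x| < T * φ) : |quantize φ T r x| ≤ T * φ := by
  have hT' : (0 : ℝ) < T := by exact_mod_cast hT
  have hr' : (0 : ℝ) < r := by exact_mod_cast hr
  have hc : 0 < T * φ := by positivity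
  obtain ⟨hx1, hx2⟩ := abs_lt.1 hx
  have h0 : (0 : ℤ) ≤ ⌊r * (x + T * φ) / (2 * (T * φ))⌋ :=
    Int.floor_nonneg.2 (div_nonneg (mul_nonneg hr'.le (by linarith)) (by positivity))
  have h1 : ⌊r * (x + T * φ) / (2 * (T * φ))⌋ < (r : ℤ) := by
    rw [Int.floor_lt, div_lt_iff₀ (by positivity)]
    push_cast
    exact mul_lt_mul_of_pos_left (by linarith) hr'
  have h0' : (0 : ℝ) ≤ (⌊r * (x + T * φ) / (2 * (T * φ))⌋ : ℝ) := by exact_mod_cast h0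
  have h1' : (⌊r * (x + T * φ) / (2 * (T * φ))⌋ : ℝ) ≤ r - 1 := by
    have : ⌊r * (x + T * φ) / (2 * (T * φ))⌋ ≤ (r : ℤ) - 1 := by omega
    exact_mod_cast this
  unfold quantize
  generalize (⌊r * (x + T * φ) / (2 * (T * φ))⌋ : ℝ) = z at h0' h1'
  have hs : 0 < 2 * (T * φ) / r := by positivity
  have h2 : 0 ≤ z * (2 * (T * φ) / r) := by positivity
  have h3 : z * (2 * (T * φ) / r) ≤ (r - 1) * (2 * (T * φ) / r) := by gcongr
  have h4 : (r - 1) * (2 * (T * φ) / r) = 2 * (T * φ) - 2 * (T * φ / r) := by field_simp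
  have h5 : 0 < T * φ / r := by positivity
  rw [abs_le]
  constructor <;> linarith

variable {Ω : Type*} {K : ℕ} {Y : Fin K → Type*} {f₀ f₁ : ∀ k, Y k → ℝ}
  {y : ∀ k, ℕ → Ω → Y k} {φ : ℝ} {ω : Ω}

lemma abs_localLLR_sub_lt {T : ℕ} (hT : 1 ≤ T)
    (h : ∀ k t, |llrIncrement f₀ f₁ y k t ω| < φ) (k : Fin K) (j : ℕ) :
    |localLLR f₀ f₁ y k ((j + 1) * T) ω - localLLR f₀ f₁ y k (j * T) ω| < T * φ := by
  have hs : localLLR f₀ f₁ y k ((j + 1) * T) ω - localLLR f₀ f₁ y k (j * T) ω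
      = ∑ n ∈ Finset.range T, llrIncrement f₀ f₁ y k (j * T + n) ω := by
    rw [localLLR, localLLR, add_mul, one_mul, Finset.sum_range_add]
    ring
  rw [hs]
  refine (Finset.abs_sum_le_sum_abs _ _).trans_lt ((Finset.sum_lt_sum_of_nonempty
    (Finset.nonempty_range_iff.2 (by omega)) fun n _ => h k _).trans_le ?_)
  simp

lemma abs_quantizedLLR_succ_sub_le (hφ : 0 < φ) {T r : ℕ} (hT : 1 ≤ T) (hr : 1 ≤ r)
    (h : ∀ k t, |llrIncrement f₀ f₁ y k t ω| < φ) (n : ℕ) :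
    |quantizedLLR f₀ f₁ y φ T r (n + 1) ω - quantizedLLR f₀ f₁ y φ T r n ω| ≤ T * (K * φ) := by
  rw [quantizedLLR, quantizedLLR, Finset.sum_range_succ, add_sub_cancel_left]
  refine (Finset.abs_sum_le_sum_abs _ _).trans ((Finset.sum_le_sum fun k _ =>
    abs_quantize_le hφ hT hr (abs_localLLR_sub_lt hT h k n)).trans (le_of_eq ?_))
  simp only [Finset.sum_const, Finset.card_univ, Fintype.card_fin, nsmul_eq_mul]
  ring

/-- Each of the `K` sensors errs by at most `T φ / r` per period, which amounts to `K φ / r` per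
time step. -/
lemma abs_quantizedLLR_sub_le (hφ : 0 < φ) {T r : ℕ} (hT : 1 ≤ T) (hr : 1 ≤ r) (n : ℕ) (ω : Ω) :
    |quantizedLLR f₀ f₁ y φ T r n ω - globalLLR f₀ f₁ y (T * n) ω|
      ≤ K * φ / r * (T * n : ℕ) := by
  have hg : globalLLR f₀ f₁ y (T * n) ω = ∑ j ∈ Finset.range n, ∑ k,
      (localLLR f₀ f₁ y k ((j + 1) * T) ω - localLLR f₀ f₁ y k (j * T) ω) := by
    rw [Finset.sum_comm, globalLLR]
    refine Finset.sum_congr rfl fun k _ => ?_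
    rw [Finset.sum_range_sub (fun j => localLLR f₀ f₁ y k (j * T) ω), mul_comm]
    simp [localLLR]
  rw [hg, quantizedLLR, ← Finset.sum_sub_distrib]
  refine le_trans (b := ∑ j ∈ Finset.range n, (K * (T * φ / r) : ℝ))
    ((Finset.abs_sum_le_sum_abs _ _).trans (Finset.sum_le_sum fun j _ => ?_)) (le_of_eq ?_)
  · rw [← Finset.sum_sub_distrib]
    refine (Finset.abs_sum_le_sum_abs _ _).trans ((Finset.sum_le_sum fun k _ =>
      abs_quantize_sub_le hφ hT hr _).trans (le_of_eq ?_))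
    simp
  · simp only [Finset.sum_const, Finset.card_range, nsmul_eq_mul]
    push_cast
    ring

lemma measurable_quantizedLLR [m : MeasurableSpace Ω] [∀ k, MeasurableSpace (Y k)]
    (hf₀ : ∀ k, Measurable (f₀ k)) (hf₁ : ∀ k, Measurable (f₁ k))
    (hy : ∀ k t, Measurable (y k t)) (φ : ℝ) (T r n : ℕ) :
    Measurable[obsFiltration y hy (T * n)] (quantizedLLR f₀ f₁ y φ T r n) := by
  have hq : Measurable (quantize φ T r) := by
    unfold quantize
    refine measurable_const.add (Measurable.mul_const ?_ _)
    exact (measurable_from_top (f := fun z : ℤ => (z : ℝ))).comp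
      (Int.measurable_floor.comp (by fun_prop))
  have hloc : ∀ k t, t ≤ T * n → Measurable[obsFiltration y hy (T * n)] (localLLR f₀ f₁ y k t) :=
    fun k t ht => Finset.measurable_sum _ fun i hi =>
      measurable_llrIncrement hf₀ hf₁ hy k ((Finset.mem_range.1 hi).trans_le ht)
  refine Finset.measurable_sum _ fun j hj => Finset.measurable_sum _ fun k _ => hq.comp ?_
  have hjn := Finset.mem_range.1 hj
  exact (hloc k _ (by rw [mul_comm T]; exact Nat.mul_le_mul_right T hjn)).sub
    (hloc k _ (by rw [mul_comm T]; exact Nat.mul_le_mul_right T hjn.le))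

end Quantizer

/-! ### Transfer to both hypotheses. -/

section Comparison

variable {Ω : Type*} [m : MeasurableSpace Ω] {P : Measure Ω} {K : ℕ} {Y : Fin K → Type*}
  {f₀ f₁ : ∀ k, Y k → ℝ} {y : ∀ k, ℕ → Ω → Y k} {φ : ℝ}

/-- The second half serves `H₀`. The quantizer need not be odd, so the statistic is negated after
quantization rather than recomputed from the negated increments. -/
lemma isApprox_quantizedLLR [∀ k, MeasurableSpace (Y k)] (hf₀ : ∀ k, Measurable (f₀ k))
    (hf₁ : ∀ k, Measurable (f₁ k)) (hy : ∀ k t, Measurable (y k t)) (hφ : 0 < φ)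
    (h : ∀ k t, ∀ᵐ ω ∂P, |llrIncrement f₀ f₁ y k t ω| < φ) {T r : ℕ} (hT : 1 ≤ T) (hr : 1 ≤ r) :
    IsApprox P (obsFiltration y hy) (globalIncrement f₀ f₁ y) (K * φ) T (K * φ / r)
      (quantizedLLR f₀ f₁ y φ T r) ∧
    IsApprox P (obsFiltration y hy) (globalIncrement f₁ f₀ y) (K * φ) T (K * φ / r)
      (fun n ω => -quantizedLLR f₀ f₁ y φ T r n ω) := by
  have hae : ∀ᵐ ω ∂P, ∀ k t, |llrIncrement f₀ f₁ y k t ω| < φ :=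
    ae_all_iff.2 fun k => ae_all_iff.2 fun t => h k t
  have hm := measurable_quantizedLLR hf₀ hf₁ hy φ T r
  have hneg : ∀ n ω, walk (globalIncrement f₁ f₀ y) n ω = -globalLLR f₀ f₁ y n ω := by
    intro n ω
    rw [globalLLR_eq_walk]
    simp only [walk, globalIncrement, llrIncrement_swap (f₀ := f₀) (f₁ := f₁),
      Finset.sum_neg_distrib]
  constructor
  · refine ⟨hm, fun ω => by simp [quantizedLLR], ?_, Eventually.of_forall fun ω n => ?_⟩
    · filter_upwards [hae] with ω hω n
      linarith [(abs_le.1 (abs_quantizedLLR_succ_sub_le hφ hT hr hω n)).2]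
    · rw [← globalLLR_eq_walk]
      exact abs_quantizedLLR_sub_le hφ hT hr n ω
  · refine ⟨fun n => (hm n).neg, fun ω => by simp [quantizedLLR], ?_,
      Eventually.of_forall fun ω n => ?_⟩
    · filter_upwards [hae] with ω hω n
      linarith [(abs_le.1 (abs_quantizedLLR_succ_sub_le hφ hT hr hω n)).1]
    · rw [hneg, neg_sub_neg, abs_sub_comm]
      exact abs_quantizedLLR_sub_le hφ hT hr n ω

/-- Translates the bound in terms of the total drift `a` and `b = K φ` into the information number
`|a| / K`. -/
lemma bound_eq {K : ℕ} (hK : 1 ≤ K) (L a φ r T e e' h : ℝ) :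
    L * (2 / a ^ 2 * (K * φ / r) * (1 + e)) + T * (K * φ / |a|) * (1 + e') + h
      = 2 * L / (K * (|a| / K) ^ 2) * (φ / r) * (1 + e) + T * (φ / (|a| / K)) * (1 + e') + h := by
  have hK' : (K : ℝ) ≠ 0 := by exact_mod_cast (by omega : K ≠ 0)
  have h1 : (K : ℝ) * (|a| / K) ^ 2 = a ^ 2 / K := by
    rw [div_pow, sq_abs]; field_simp
  rw [h1, div_div_eq_mul_div, div_div_eq_mul_div]
  ring

end Comparison

end

end QSPRT

/-! ### The main theorem. -/

theorem theorem1
    {Ω : Type*} [MeasurableSpace Ω] (P₀ P₁ : Measure Ω)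
    [IsProbabilityMeasure P₀] [IsProbabilityMeasure P₁]
    (K : ℕ) (hK : 1 ≤ K) (Y : Fin K → Type*) [∀ k, MeasurableSpace (Y k)]
    (ν : ∀ k, Measure (Y k)) (f₀ f₁ : ∀ k, Y k → ℝ)
    (hf₀ : ∀ k, QSPRT.IsDensity (ν k) (f₀ k)) (hf₁ : ∀ k, QSPRT.IsDensity (ν k) (f₁ k))
    (y : ∀ k, ℕ → Ω → Y k) (hy : ∀ k t, Measurable (y k t))
    (hP₀ : QSPRT.ObservationLaw ν f₀ y P₀) (hP₁ : QSPRT.ObservationLaw ν f₁ y P₁)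
    -- the log-likelihood ratio of every observation is well defined and bounded by `φ`
    (φ : ℝ)
    (hφ₀ : ∀ k t, ∀ᵐ ω ∂P₀, 0 < f₀ k (y k t ω) ∧ 0 < f₁ k (y k t ω) ∧
      |QSPRT.llrIncrement f₀ f₁ y k t ω| < φ)
    (hφ₁ : ∀ k t, ∀ᵐ ω ∂P₁, 0 < f₀ k (y k t ω) ∧ 0 < f₁ k (y k t ω) ∧
      |QSPRT.llrIncrement f₀ f₁ y k t ω| < φ) :
    -- the terms `o_r(1)`, which depend only on the number `r` of quantization levels
    ∃ ε₁ ε₁' ε₀ ε₀' : ℕ → ℝ,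
      Tendsto ε₁ atTop (𝓝 0) ∧ Tendsto ε₁' atTop (𝓝 0) ∧
      Tendsto ε₀ atTop (𝓝 0) ∧ Tendsto ε₀' atTop (𝓝 0) ∧
    ∃ r₀ : ℕ,
    -- `C` quantifies "`α` and `β` tend to `0` at the same rate"
    ∀ C : ℝ,
    -- the terms `o_α(1)` and `o_β(1)`
    ∃ η₁ η₀ : ℝ → ℝ,
      Tendsto η₁ (𝓝[>] 0) (𝓝 0) ∧ Tendsto η₀ (𝓝[>] 0) (𝓝 0) ∧
    ∀ α β : ℝ, 0 < α → α < 1 → 0 < β → β < 1 → α ≤ C * β → β ≤ C * α →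
    ∀ T r : ℕ, 1 ≤ T → r₀ ≤ r →
    ∀ A B A' B' : ℝ,
      QSPRT.MeetsErrors P₀ P₁ (QSPRT.globalLLR f₀ f₁ y) A B α β →
      QSPRT.MeetsErrors P₀ P₁ (QSPRT.quantizedLLR f₀ f₁ y φ T r) A' B' α β →
      (QSPRT.expectedTime P₁ (QSPRT.sprtTime f₀ f₁ y A B) ≠ ⊤ ∧
        QSPRT.expectedTime P₁ (QSPRT.qsprtTime f₀ f₁ y φ T r A' B') ≠ ⊤ ∧
        0 ≤ (QSPRT.expectedTime P₁ (QSPRT.qsprtTime f₀ f₁ y φ T r A' B')).toReal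
            - (QSPRT.expectedTime P₁ (QSPRT.sprtTime f₀ f₁ y A B)).toReal ∧
        (QSPRT.expectedTime P₁ (QSPRT.qsprtTime f₀ f₁ y φ T r A' B')).toReal
            - (QSPRT.expectedTime P₁ (QSPRT.sprtTime f₀ f₁ y A B)).toReal
          ≤ 2 * |Real.log α| / (K * QSPRT.infoNumber f₀ f₁ y P₁ ^ 2) * (φ / r) * (1 + ε₁ r)
            + T * (φ / QSPRT.infoNumber f₀ f₁ y P₁) * (1 + ε₁' r) + η₁ α) ∧
      (QSPRT.expectedTime P₀ (QSPRT.sprtTime f₀ f₁ y A B) ≠ ⊤ ∧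
        QSPRT.expectedTime P₀ (QSPRT.qsprtTime f₀ f₁ y φ T r A' B') ≠ ⊤ ∧
        0 ≤ (QSPRT.expectedTime P₀ (QSPRT.qsprtTime f₀ f₁ y φ T r A' B')).toReal
            - (QSPRT.expectedTime P₀ (QSPRT.sprtTime f₀ f₁ y A B)).toReal ∧
        (QSPRT.expectedTime P₀ (QSPRT.qsprtTime f₀ f₁ y φ T r A' B')).toReal
            - (QSPRT.expectedTime P₀ (QSPRT.sprtTime f₀ f₁ y A B)).toReal
          ≤ 2 * |Real.log β| / (K * QSPRT.infoNumber f₀ f₁ y P₀ ^ 2) * (φ / r) * (1 + ε₀ r)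
            + T * (φ / QSPRT.infoNumber f₀ f₁ y P₀) * (1 + ε₀' r) + η₀ β) := by
  -- Positivity of `φ` follows from the strict bound at one observation, available since there is a
  -- sensor.
  have hφ : 0 < φ := by
    obtain ⟨ω, hω⟩ := (hφ₁ ⟨0, hK⟩ 0).exists
    exact (abs_nonneg _).trans_lt hω.2.2
  have hKφ : 0 < (K : ℝ) * φ := mul_pos (by exact_mod_cast hK) hφ
  have M₁ := QSPRT.llrModel (φ := φ) hf₀ hf₁ hy hP₀ hP₁ (fun k t => (hφ₀ k t).mono fun ω h => h.2.1)
    (fun k t => (hφ₁ k t).mono fun ω h => ⟨h.1, h.2.2⟩)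
  -- The same model with the hypotheses exchanged, in which the log-likelihood ratios change sign.
  have M₀ := QSPRT.llrModel (φ := φ) hf₁ hf₀ hy hP₁ hP₀ (fun k t => (hφ₁ k t).mono fun ω h => h.1)
    (fun k t => (hφ₀ k t).mono fun ω h => ⟨h.2.1, by
      rw [QSPRT.llrIncrement_swap, abs_neg]; exact h.2.2⟩)
  obtain ⟨ε₁, ε₁', h1, h1', r₁, hr₁, H₁⟩ := M₁.asymptotics hKφ
  obtain ⟨ε₀, ε₀', h0, h0', r₀, hr₀, H₀⟩ := M₀.asymptotics hKφ
  refine ⟨ε₁, ε₁', ε₀, ε₀', h1, h1', h0, h0', max r₁ r₀, fun C => ?_⟩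
  obtain ⟨η₁, hη₁, H₁⟩ := H₁ C
  obtain ⟨η₀, hη₀, H₀⟩ := H₀ C
  refine ⟨η₁, η₀, hη₁, hη₀, ?_⟩
  intro α β hα hα1 hβ hβ1 hαβ hβα T r hT hr A B A' B' hS hQ
  have hr1 : 1 ≤ r := hr₁.trans ((le_max_left _ _).trans hr)
  obtain ⟨hA, hB, hα2, hβ2⟩ := hS
  obtain ⟨hA', hB', hα3, hβ3⟩ := hQ
  have hneg : QSPRT.walk (QSPRT.globalIncrement f₁ f₀ y)
      = fun n ω => -QSPRT.globalLLR f₀ f₁ y n ω := by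
    funext n ω
    rw [QSPRT.globalLLR_eq_walk]
    simp only [QSPRT.walk, QSPRT.globalIncrement, QSPRT.llrIncrement_swap (f₀ := f₀) (f₁ := f₁),
      Finset.sum_neg_distrib]
  have hone : ∀ ω, QSPRT.globalLLR f₀ f₁ y 1 ω = QSPRT.globalIncrement f₀ f₁ y 0 ω := fun ω => by
    simp [QSPRT.globalLLR_eq_walk, QSPRT.walk]
  have hinfo₁ : QSPRT.infoNumber f₀ f₁ y P₁
      = |∫ ω, QSPRT.globalIncrement f₀ f₁ y 0 ω ∂P₁| / K := by
    simp only [QSPRT.infoNumber, hone]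
  have hinfo₀ : QSPRT.infoNumber f₀ f₁ y P₀
      = |∫ ω, QSPRT.globalIncrement f₁ f₀ y 0 ω ∂P₀| / K := by
    have : ∀ ω, QSPRT.globalIncrement f₁ f₀ y 0 ω = -QSPRT.globalIncrement f₀ f₁ y 0 ω := fun ω => by
      simp only [QSPRT.globalIncrement, QSPRT.llrIncrement_swap (f₀ := f₀) (f₁ := f₁),
        Finset.sum_neg_distrib]
    simp only [QSPRT.infoNumber, hone, this, integral_neg, abs_neg]
  have hZ₁ := (QSPRT.isApprox_quantizedLLR (P := P₁) (fun k => (hf₀ k).1) (fun k => (hf₁ k).1) hy hφ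
    (fun k t => (hφ₁ k t).mono fun ω h => h.2.2) hT hr1).1
  have hZ₀ := (QSPRT.isApprox_quantizedLLR (P := P₀) (fun k => (hf₀ k).1) (fun k => (hf₁ k).1) hy hφ
    (fun k t => (hφ₀ k t).mono fun ω h => h.2.2) hT hr1).2
  have R₁ := H₁ α β hα hα1 hβ hαβ hβα T r hT ((le_max_left _ _).trans hr) A B A' B' hA hB hA' hB'
    _ hZ₁
  rw [← QSPRT.globalLLR_eq_walk, QSPRT.bound_eq hK, ← hinfo₁] at R₁
  -- Error probabilities and thresholds trade places; the reflection lemmas then restore the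
  -- original tests.
  have R₀ := H₀ β α hβ hβ1 hα hβα hαβ T r hT ((le_max_right _ _).trans hr) B A B' A' hB hA hB' hA'
    _ hZ₀
  rw [hneg, QSPRT.bound_eq hK, ← hinfo₀] at R₀
  simp only [QSPRT.exitTime_neg, QSPRT.decideOne_neg, QSPRT.decideZero_neg] at R₀
  exact ⟨R₁ hα2 hβ2 hα3 hβ3, R₀ hβ2 hα2 hβ3 hα3⟩
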